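/- Let $\mathbb O$ be the real octonions with standard basis $e_0=1,e_1,\dots,e_7$. An **$\mathbb O$-bimodule** is a real vector space $M$ with $\mathbb R$-bilinear left and right multiplications $\mathbb O\times M\to M$, $M\times\mathbb O\to M$ such that $1m=m=m1$ and $$[p,q,m]=-[q,p,m]=[m,p,q]=[q,m,p]\qquad(p,q\in\mathbb O,\ m\in M),\qquad [x,y,z]:=(xy)z-x(yz).$$ Its nucleus is $\{m\in M:[p,q,m]=0\ \text{for all } p,q\in\mathbb O\}$; $M$ is the direct sum of the $e_i\cdot\mathrm{nucleus}$ ($0\le i\le 7$), and $\mathrm{Re}:M\to M$ denotes the projection onto the nucleus, the summand with $i=0$. For $\mathbb O$-bimodules $M,M'$, an $\mathbb R$-linear map $f:M\to M'$, $p\in\mathbb O$ and $x\in M$ put $A_p(x,f)=f(px)-pf(x)$ and $B_p(f,x)=f(x)p-f(xp)$. Let $\mathrm{Hom}_{\mathcal{LO}}(M,M')$ (left para-linear maps) be the set of those $f$ with $\mathrm{Re}\,A_p(x,f)=0$ for all $p,x$, and $\mathrm{Hom}_{\mathcal{RO}}(M,M')$ (right para-linear maps) the set of those with $\mathrm{Re}\,B_p(f,x)=0$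 for all $p,x$. Both are $\mathbb O$-bimodules, under $$(r\odot f)(x)=f(xr)+A_r(x,f),\qquad (f\odot r)(x)=f(x)r-A_r(x,f)$$ in the left case, and $$(r\odot f)(x)=rf(x)+B_r(f,x),\qquad (f\odot r)(x)=f(rx)-B_r(f,x)$$ in the right case. The left, respectively right, regular composition of $g:M\to M'$ and $f:M'\to M''$, both left (respectively right) para-linear, is $$(f\circledcirc_l g)(x)=f(g(x))-\sum_{j=1}^7 e_j\,\mathrm{Re}\,f(A_{e_j}(x,g)),\qquad (f\circledcirc_r g)(x)=f(g(x))+\sum_{j=1}^7 \mathrm{Re}\,f(B_{e_j}(g,x))\,e_j,$$ and it is again left (respectively right) para-linear. Let $\mathcal{LO}$ (respectively $\mathcal{RO}$) be the non-associative category whose objects are the $\mathbb O$-bimodules, whose morphisms are the left (right) para-linear maps and whose composition is $\circledcirc_l$ ($\circledcirc_r$). A (covariant or contravariant) functor between non-associative categories is required to preserve compositions (reversing their order in the contravariant case) and identities. **Theorem.** Let $M$ be an $\mathbb O$-bimodule. 1. For every $f\in\mathrm{Hom}_{\mathcal{LO}}(X,Y)$ the map $T(f):\mathrm{Hom}_{\mathcal{LO}}(M,X)\to\mathrm{Hom}_{\mathcal{LO}}(M,Y)$,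 $T(f)(g)=f\circledcirc_l g$, is left para-linear, and $T=\mathrm{Hom}_{\mathcal{LO}}(M,-)$, $X\mapsto\mathrm{Hom}_{\mathcal{LO}}(M,X)$, $f\mapsto T(f)$, is a covariant functor $\mathcal{LO}\to\mathcal{LO}$. 2. For every $f\in\mathrm{Hom}_{\mathcal{LO}}(X,Y)$ the map $S(f):\mathrm{Hom}_{\mathcal{LO}}(Y,M)\to\mathrm{Hom}_{\mathcal{LO}}(X,M)$, $S(f)(g)=g\circledcirc_l f$, is right para-linear, and $S=\mathrm{Hom}_{\mathcal{LO}}(-,M)$, $X\mapsto\mathrm{Hom}_{\mathcal{LO}}(X,M)$, $f\mapsto S(f)$, is a contravariant functor $\mathcal{LO}\to\mathcal{RO}$. 3. Both functors are $\mathbb O$-linear: for all $X,Y$ the maps $f\mapsto T(f)$ and $f\mapsto S(f)$ on $\mathrm{Hom}_{\mathcal{LO}}(X,Y)$ are $\mathbb R$-linear and satisfy $T(p\odot f)=p\odot T(f)$, $T(f\odot p)=T(f)\odot p$, $S(p\odot f)=p\odot S(f)$ and $S(f\odot p)=S(f)\odot p$ for all $p\in\mathbb O$. -/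

import Mathlib

set_option linter.all false

/-- The octonions, as real coordinate vectors `(x 0, …, x 7)` with respect to the basis
`e 0 = 1, e 1, …, e 7`. -/
def Octonion : Type := Fin 8 → ℝ

notation "𝕆" => Octonion

namespace Octonion

noncomputable instance : AddCommGroup 𝕆 := inferInstanceAs (AddCommGroup (Fin 8 → ℝ))
noncomputable instance : Module ℝ 𝕆 := inferInstanceAs (Module ℝ (Fin 8 → ℝ))

/-- The basis `e 0 = 1, e 1, …, e 7`. -/
def e (i : Fin 8) : 𝕆 := fun j => if i = j then 1 else 0

instance : One 𝕆 := ⟨e 0⟩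

/-- The bilinear product with unit `e 0`, `e i * e i = -1` for `i ≠ 0`, and
`e i * e j = e k = -(e j * e i)` for all cyclic permutations of the triples `(i, j, k)` among
`(1, 2, 3), (1, 4, 5), (1, 6, 7), (2, 4, 6), (2, 7, 5), (3, 7, 4), (3, 6, 5)`. -/
noncomputable instance : Mul 𝕆 := ⟨fun x y =>
  ![x 0 * y 0 - x 1 * y 1 - x 2 * y 2 - x 3 * y 3 - x 4 * y 4 - x 5 * y 5 - x 6 * y 6 - x 7 * y 7,
    x 0 * y 1 + x 1 * y 0 + (x 2 * y 3 - x 3 * y 2) + (x 4 * y 5 - x 5 * y 4) + (x 6 * y 7 - x 7 * y 6),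
    x 0 * y 2 + x 2 * y 0 + (x 3 * y 1 - x 1 * y 3) + (x 4 * y 6 - x 6 * y 4) + (x 7 * y 5 - x 5 * y 7),
    x 0 * y 3 + x 3 * y 0 + (x 1 * y 2 - x 2 * y 1) + (x 7 * y 4 - x 4 * y 7) + (x 6 * y 5 - x 5 * y 6),
    x 0 * y 4 + x 4 * y 0 + (x 5 * y 1 - x 1 * y 5) + (x 6 * y 2 - x 2 * y 6) + (x 3 * y 7 - x 7 * y 3),
    x 0 * y 5 + x 5 * y 0 + (x 1 * y 4 - x 4 * y 1) + (x 2 * y 7 - x 7 * y 2) + (x 3 * y 6 - x 6 * y 3),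
    x 0 * y 6 + x 6 * y 0 + (x 7 * y 1 - x 1 * y 7) + (x 2 * y 4 - x 4 * y 2) + (x 5 * y 3 - x 3 * y 5),
    x 0 * y 7 + x 7 * y 0 + (x 1 * y 6 - x 6 * y 1) + (x 5 * y 2 - x 2 * y 5) + (x 4 * y 3 - x 3 * y 4)]⟩

theorem ext8 {x y : 𝕆} (h0 : x 0 = y 0) (h1 : x 1 = y 1) (h2 : x 2 = y 2) (h3 : x 3 = y 3)
    (h4 : x 4 = y 4) (h5 : x 5 = y 5) (h6 : x 6 = y 6) (h7 : x 7 = y 7) : x = y := by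
  funext i; fin_cases i <;> assumption

section coords
variable (x y : 𝕆)
theorem mul_0 : (x * y) 0 = x 0 * y 0 - x 1 * y 1 - x 2 * y 2 - x 3 * y 3 - x 4 * y 4 - x 5 * y 5
    - x 6 * y 6 - x 7 * y 7 := rfl
theorem mul_1 : (x * y) 1 = x 0 * y 1 + x 1 * y 0 + (x 2 * y 3 - x 3 * y 2)
    + (x 4 * y 5 - x 5 * y 4) + (x 6 * y 7 - x 7 * y 6) := rfl
theorem mul_2 : (x * y) 2 = x 0 * y 2 + x 2 * y 0 + (x 3 * y 1 - x 1 * y 3)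
    + (x 4 * y 6 - x 6 * y 4) + (x 7 * y 5 - x 5 * y 7) := rfl
theorem mul_3 : (x * y) 3 = x 0 * y 3 + x 3 * y 0 + (x 1 * y 2 - x 2 * y 1)
    + (x 7 * y 4 - x 4 * y 7) + (x 6 * y 5 - x 5 * y 6) := rfl
theorem mul_4 : (x * y) 4 = x 0 * y 4 + x 4 * y 0 + (x 5 * y 1 - x 1 * y 5)
    + (x 6 * y 2 - x 2 * y 6) + (x 3 * y 7 - x 7 * y 3) := rfl
theorem mul_5 : (x * y) 5 = x 0 * y 5 + x 5 * y 0 + (x 1 * y 4 - x 4 * y 1)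
    + (x 2 * y 7 - x 7 * y 2) + (x 3 * y 6 - x 6 * y 3) := rfl
theorem mul_6 : (x * y) 6 = x 0 * y 6 + x 6 * y 0 + (x 7 * y 1 - x 1 * y 7)
    + (x 2 * y 4 - x 4 * y 2) + (x 5 * y 3 - x 3 * y 5) := rfl
theorem mul_7 : (x * y) 7 = x 0 * y 7 + x 7 * y 0 + (x 1 * y 6 - x 6 * y 1)
    + (x 5 * y 2 - x 2 * y 5) + (x 4 * y 3 - x 3 * y 4) := rfl
theorem add_apply (i : Fin 8) : (x + y) i = x i + y i := rfl
theorem sub_apply (i : Fin 8) : (x - y) i = x i - y i := rfl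
theorem neg_apply (i : Fin 8) : (-x) i = -x i := rfl
theorem smul_apply (r : ℝ) (i : Fin 8) : (r • x) i = r * x i := rfl
theorem e_apply (i j : Fin 8) : e i j = if i = j then 1 else 0 := rfl
end coords

protected theorem add_mul (x y z : 𝕆) : (x + y) * z = x * z + y * z := by
  apply ext8 <;> simp only [mul_0, mul_1, mul_2, mul_3, mul_4, mul_5, mul_6, mul_7, add_apply] <;> ring
protected theorem mul_add (x y z : 𝕆) : x * (y + z) = x * y + x * z := by
  apply ext8 <;> simp only [mul_0, mul_1, mul_2, mul_3, mul_4, mul_5, mul_6, mul_7, add_apply] <;> ring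
protected theorem smul_mul (r : ℝ) (x y : 𝕆) : (r • x) * y = r • (x * y) := by
  apply ext8 <;> simp only [mul_0, mul_1, mul_2, mul_3, mul_4, mul_5, mul_6, mul_7, smul_apply] <;> ring
protected theorem mul_smul (r : ℝ) (x y : 𝕆) : x * (r • y) = r • (x * y) := by
  apply ext8 <;> simp only [mul_0, mul_1, mul_2, mul_3, mul_4, mul_5, mul_6, mul_7, smul_apply] <;> ring

theorem eq_sum (x : 𝕆) : x = ∑ i, x i • e i := by
  rw [Fin.sum_univ_eight]
  apply ext8 <;> simp [add_apply, smul_apply, e_apply]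

protected theorem one_mul (x : 𝕆) : 1 * x = x := by
  change e 0 * x = x
  apply ext8 <;> simp [mul_0, mul_1, mul_2, mul_3, mul_4, mul_5, mul_6, mul_7, e_apply]

protected theorem mul_one (x : 𝕆) : x * 1 = x := by
  change x * e 0 = x
  apply ext8 <;> simp [mul_0, mul_1, mul_2, mul_3, mul_4, mul_5, mul_6, mul_7, e_apply]

theorem key {A : Type*} [Ring A] {L1 L2 L3 R1 R2 R3 : A}
  (h0 : R3 * R3 + 1 = 0) (h1 : R3 * R2 = R1 + L1 - L2 * L3) (h2 : R3 * R1 = -(R2 + L2 - L3 * L1))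
  (h3 : R3 * L1 = L1 * R3 + L2 - L3 * L1) (h4 : R3 * L2 = L2 * R3 - L1 - L3 * L2)
  (h5 : L3 * L2 = - (L2 * L3))  (h8 : R3 * L3 = L3 * R3) :
  (L1 - L2 * L3) * (R3 + L3) = 0 := by
  linear_combination (norm := noncomm_ring) h0 * R2 - R3 * h1 - h2 - h3 + h4 * L3 + L2 * h8 - h5 * L3

theorem sq' {A : Type*} [Ring A] (L : Fin 8 → A)
    (hsq : ∀ i, 0 < i → L i * L i = -1) : ∀ i x, 0 < i → L i * (L i * x) = -x := by
  intro i x h; rw [← mul_assoc, hsq i h]; simp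
theorem anti' {A : Type*} [Ring A] (L : Fin 8 → A)
    (hanti : ∀ i j, 0 < j → j < i → L i * L j = -(L j * L i)) : ∀ i j x, 0 < j → j < i → L i * (L j * x) = -(L j * (L i * x)) := by
  intro i j x h h'; rw [← mul_assoc, hanti i j h h']; simp [mul_assoc]

theorem omega {A : Type*} [Ring A] (L : Fin 8 → A)
    (hsq : ∀ i, 0 < i → L i * L i = -1)
    (hanti : ∀ i j, 0 < j → j < i → L i * L j = -(L j * L i)) {R1 : A}
  (ka : (L 2 - L 3 * L 1) * (R1 + L 1) = 0)
  (kb : (L 4 - L 5 * L 1) * (R1 + L 1) = 0)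
  (kc : (L 6 - L 7 * L 1) * (R1 + L 1) = 0)
  (hr : R1 * L 2 = L 2 * R1 + L 3 - L 1 * L 2) (h2 : ∀ x : A, x + x = 0 → x = 0) :
  L 1 * (L 2 * (L 3 * (L 4 * (L 5 * (L 6 * L 7))))) = 1 := by
  have hs' := sq' L hsq
  have ha' := anti' L hanti
  have ta : L 1 * L 2 * L 3 * (R1 + L 1) = -(R1 + L 1) := by
    have h : L 1 * L 2 * L 3 = L 2 * (L 3 * L 1) := by
      simp [mul_assoc, hanti, ha']
    have hs : L 2 * L 2 + 1 = 0 := by rw [hsq 2 (by decide)]; simp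
    rw [h]
    linear_combination (norm := noncomm_ring) hs * (R1 + L 1) - L 2 * ka
  have tb : L 1 * L 4 * L 5 * (R1 + L 1) = -(R1 + L 1) := by
    have h : L 1 * L 4 * L 5 = L 4 * (L 5 * L 1) := by
      simp [mul_assoc, hanti, ha']
    have hs : L 4 * L 4 + 1 = 0 := by rw [hsq 4 (by decide)]; simp
    rw [h]
    linear_combination (norm := noncomm_ring) hs * (R1 + L 1) - L 4 * kb
  have tc : L 1 * L 6 * L 7 * (R1 + L 1) = -(R1 + L 1) := by
    have h : L 1 * L 6 * L 7 = L 6 * (L 7 * L 1) := by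
      simp [mul_assoc, hanti, ha']
    have hs : L 6 * L 6 + 1 = 0 := by rw [hsq 6 (by decide)]; simp
    rw [h]
    linear_combination (norm := noncomm_ring) hs * (R1 + L 1) - L 6 * kc
  set W := L 1 * (L 2 * (L 3 * (L 4 * (L 5 * (L 6 * L 7))))) with hW
  have hWp : W = -((L 1 * L 2 * L 3) * (L 1 * L 4 * L 5) * (L 1 * L 6 * L 7)) := by
    simp [hW, mul_assoc, hanti, ha', hsq, hs']
  have hWQ : W * (R1 + L 1) = R1 + L 1 := by
    rw [hWp, neg_mul, mul_assoc, tc, mul_neg, mul_assoc, tb, mul_neg, ta]; simp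
  have hW2 : W * L 2 = L 2 * W := by
    simp [hW, mul_assoc, hanti, ha', hsq, hs']
  have hW4 : W * L 4 = L 4 * W := by
    simp [hW, mul_assoc, hanti, ha', hsq, hs']
  clear_value W
  have e1 : (1 - W) * R1 = -((1 - W) * L 1) := by
    linear_combination (norm := noncomm_ring) -hWQ
  have e2 : (1 - W) * (R1 * L 2) = (1 - W) * (L 2 * R1 + L 3 - L 1 * L 2) := by rw [hr]
  have e21 := hanti 2 1 (by decide) (by decide)
  have e3 : (1 - W) * L 3 = -((1 - W) * (L 1 * L 2)) := by
    linear_combination (norm := noncomm_ring) -e2 + e1 * L 2 - L 2 * e1 + hW2 * R1 + hW2 * L 1 + (1 - W) * e21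
  have e4 : (1 - W) * (L 1 * (L 2 * L 3)) = 1 - W := by
    have := congrArg (· * L 3) e3
    simp only [mul_assoc, neg_mul, hsq 3 (by decide)] at this
    rw [← neg_eq_iff_eq_neg.mpr this]; simp
  have e5 : L 1 * (L 2 * L 3) * L 4 = - (L 4 * (L 1 * (L 2 * L 3))) := by
    simp [mul_assoc, hanti, ha']
  have e6 : (1 - W) * L 4 = 0 := by
    apply h2
    linear_combination (norm := noncomm_ring) (1 - W) * e5 - e4 * L 4 - L 4 * e4 - hW4 + hW4 * (L 1 * (L 2 * L 3))
  have e7 : (1 - W) * (L 4 * L 4) = 0 := by rw [← mul_assoc, e6, zero_mul]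
  rw [hsq 4 (by decide)] at e7
  simp at e7
  exact (sub_eq_zero.mp (neg_eq_zero.mp (by simpa using e7))).symm

theorem lines_of_three {A : Type*} [Ring A] (L : Fin 8 → A)
    (hsq : ∀ i, 0 < i → L i * L i = -1)
    (hanti : ∀ i j, 0 < j → j < i → L i * L j = -(L j * L i))
    (hW : L 1 * (L 2 * (L 3 * (L 4 * (L 5 * (L 6 * L 7))))) = 1) :
    L 1 * L 6 * L 7 = -((L 1 * L 2 * L 3) * (L 1 * L 4 * L 5)) ∧
    L 2 * L 7 * L 5 = -((L 1 * L 2 * L 3) * (L 2 * L 4 * L 6)) ∧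
    L 3 * L 7 * L 4 = -((L 1 * L 4 * L 5) * (L 2 * L 4 * L 6)) ∧
    L 3 * L 6 * L 5 = (L 1 * L 2 * L 3) * (L 1 * L 4 * L 5) * (L 2 * L 4 * L 6) := by
  have hs' := sq' L hsq
  have ha' := anti' L hanti
  refine ⟨?_, ?_, ?_, ?_⟩
  · rw [← _root_.one_mul (L 1 * L 6 * L 7), ← hW]
    simp [mul_assoc, hanti, ha', hsq, hs']
  · rw [← _root_.one_mul (L 2 * L 7 * L 5), ← hW]
    simp [mul_assoc, hanti, ha', hsq, hs']
  · rw [← _root_.one_mul (L 3 * L 7 * L 4), ← hW]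
    simp [mul_assoc, hanti, ha', hsq, hs']
  · simp [mul_assoc, hanti, ha', hsq, hs']

/-- Averaging over the group generated by three commuting involutions. -/
theorem average_fixed {A : Type*} [Ring A] {a b d : A} (ha : a * a = 1) (hb : b * b = 1)
    (hd : d * d = 1) (hab : b * a = a * b) (had : d * a = a * d) (hbd : d * b = b * d) :
    (a * ((1 + a) * (1 + b) * (1 + d)) = (1 + a) * (1 + b) * (1 + d)) ∧
    (b * ((1 + a) * (1 + b) * (1 + d)) = (1 + a) * (1 + b) * (1 + d)) ∧
    (d * ((1 + a) * (1 + b) * (1 + d)) = (1 + a) * (1 + b) * (1 + d)) := by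
  have ha0 := sub_eq_zero.mpr ha
  have hb0 := sub_eq_zero.mpr hb
  have hd0 := sub_eq_zero.mpr hd
  refine ⟨?_, ?_, ?_⟩
  · linear_combination (norm := noncomm_ring) ha0 * (1 + b) * (1 + d)
  · linear_combination (norm := noncomm_ring) (1 + a) * hb0 * (1 + d) + hab * (1 + b) * (1 + d)
  · linear_combination (norm := noncomm_ring) (1 + a) * (1 + b) * hd0 + had * (1 + b) * (1 + d)
      + (1 + a) * hbd * (1 + d)

/-- `e i * e j = sgn i j • e (idx i j)`. -/
def sgn (i j : Fin 8) : ℤ :=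
  (![![1, 1, 1, 1, 1, 1, 1, 1], ![1, -1, 1, -1, 1, -1, 1, -1], ![1, -1, -1, 1, 1, -1, -1, 1],
     ![1, 1, -1, -1, -1, -1, 1, 1], ![1, -1, -1, 1, -1, 1, 1, -1], ![1, 1, 1, 1, -1, -1, -1, -1],
     ![1, -1, 1, -1, -1, 1, -1, 1], ![1, 1, -1, -1, 1, 1, -1, -1]] : Fin 8 → Fin 8 → ℤ) i j

/-- `e i * e j = sgn i j • e (idx i j)`. -/
def idx (i j : Fin 8) : Fin 8 :=
  (![![0, 1, 2, 3, 4, 5, 6, 7], ![1, 0, 3, 2, 5, 4, 7, 6], ![2, 3, 0, 1, 6, 7, 4, 5],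
     ![3, 2, 1, 0, 7, 6, 5, 4], ![4, 5, 6, 7, 0, 1, 2, 3], ![5, 4, 7, 6, 1, 0, 3, 2],
     ![6, 7, 4, 5, 2, 3, 0, 1], ![7, 6, 5, 4, 3, 2, 1, 0]] : Fin 8 → Fin 8 → Fin 8) i j
def eZ (i j : Fin 8) : ℤ := if i = j then 1 else 0
theorem e_eq_eZ (i j : Fin 8) : e i j = (eZ i j : ℝ) := by
  simp [eZ, e]
theorem e_mul_e (i j : Fin 8) : e i * e j = (sgn i j : ℝ) • e (idx i j) := by
  apply ext8 <;> simp only [mul_0, mul_1, mul_2, mul_3, mul_4, mul_5, mul_6, mul_7, smul_apply,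
    e_eq_eZ] <;> norm_cast <;> revert i j <;> decide
theorem e_mul_self (i : Fin 8) (hi : 0 < i) : e i * e i = -e 0 := by
  have h : ∀ i : Fin 8, 0 < i → sgn i i = -1 ∧ idx i i = 0 := by decide
  rw [e_mul_e, (h i hi).1, (h i hi).2]; simp

theorem e_mul_anti (i j : Fin 8) (hj : 0 < j) (hi : j < i) : e i * e j = -(e j * e i) := by
  have h : ∀ i j : Fin 8, 0 < j → j < i → sgn i j = - sgn j i ∧ idx i j = idx j i := by decide
  rw [e_mul_e, e_mul_e, (h i j hj hi).1, (h i j hj hi).2]; simp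

theorem e_mul_e_zero (i j : Fin 8) :
    (e i * e j) 0 = if i = j then (if i = 0 then 1 else -1) else 0 := by
  have h : ∀ i j : Fin 8, sgn i j * eZ (idx i j) 0 =
      if i = j then (if i = 0 then 1 else -1) else 0 := by decide
  have h1 := h i j
  rw [e_mul_e, smul_apply, e_eq_eZ]
  exact_mod_cast h1

theorem neg_mul' (x y : 𝕆) : (-x) * y = -(x * y) := by
  rw [← neg_one_smul ℝ x, Octonion.smul_mul, neg_one_smul]

theorem mul_neg' (x y : 𝕆) : x * (-y) = -(x * y) := by
  rw [← neg_one_smul ℝ y, Octonion.mul_smul, neg_one_smul]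

theorem linear_ext {M : Type*} [AddCommGroup M] [Module ℝ M] (f g : 𝕆 →ₗ[ℝ] M)
    (h : ∀ i, f (e i) = g (e i)) (x : 𝕆) : f x = g x := by
  rw [eq_sum x]; simp [h]

theorem assoc_re (p q r : 𝕆) : ((p * q) * r) 0 = (p * (q * r)) 0 := by
  simp only [mul_0, mul_1, mul_2, mul_3, mul_4, mul_5, mul_6, mul_7]; ring

theorem comm_re (p q : 𝕆) : (p * q) 0 = (q * p) 0 := by
  simp only [mul_0]; ring

end Octonion

open Octonion

/-- Octonionic bimodules: real vector spaces with bilinear left and right multiplications by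
octonions (`p ⊲ m` is `p m`, and `m ⊳ p` is `m p`) such that `1 m = m = m 1`, and such that the
associators satisfy `[p, q, m] = -[q, p, m] = [m, p, q] = [q, m, p]`, where
`[x, y, z] = (x y) z - x (y z)`. -/
class OctonionBimodule (M : Type*) [AddCommGroup M] [Module ℝ M] where
  lmul : 𝕆 → M → M
  rmul : M → 𝕆 → M
  lmul_add : ∀ (p : 𝕆) (m n : M), lmul p (m + n) = lmul p m + lmul p n
  add_lmul : ∀ (p q : 𝕆) (m : M), lmul (p + q) m = lmul p m + lmul q m
  lmul_smul : ∀ (r : ℝ) (p : 𝕆) (m : M), lmul p (r • m) = r • lmul p m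
  smul_lmul : ∀ (r : ℝ) (p : 𝕆) (m : M), lmul (r • p) m = r • lmul p m
  rmul_add : ∀ (p q : 𝕆) (m : M), rmul m (p + q) = rmul m p + rmul m q
  add_rmul : ∀ (p : 𝕆) (m n : M), rmul (m + n) p = rmul m p + rmul n p
  rmul_smul : ∀ (r : ℝ) (p : 𝕆) (m : M), rmul m (r • p) = r • rmul m p
  smul_rmul : ∀ (r : ℝ) (p : 𝕆) (m : M), rmul (r • m) p = r • rmul m p
  one_lmul : ∀ m : M, lmul 1 m = m
  rmul_one : ∀ m : M, rmul m 1 = m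
  assoc_left_alt : ∀ (p q : 𝕆) (m : M),
    lmul (p * q) m - lmul p (lmul q m) = -(lmul (q * p) m - lmul q (lmul p m))
  assoc_left_eq_right : ∀ (p q : 𝕆) (m : M),
    lmul (p * q) m - lmul p (lmul q m) = rmul (rmul m p) q - rmul m (p * q)
  assoc_left_eq_middle : ∀ (p q : 𝕆) (m : M),
    lmul (p * q) m - lmul p (lmul q m) = rmul (lmul q m) p - lmul q (rmul m p)

infixr:73 " ⊲ " => OctonionBimodule.lmul
infixl:73 " ⊳ " => OctonionBimodule.rmul

namespace OctonionBimodule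

section basic
variable {M : Type*} [AddCommGroup M] [Module ℝ M] [OctonionBimodule M]

def L (p : 𝕆) : Module.End ℝ M where
  toFun m := p ⊲ m
  map_add' := lmul_add p
  map_smul' r m := lmul_smul r p m

def R (p : 𝕆) : Module.End ℝ M where
  toFun m := m ⊳ p
  map_add' := add_rmul p
  map_smul' r m := smul_rmul r p m

/-- `p ↦ p ⊲ m` -/
def lAt (m : M) : 𝕆 →ₗ[ℝ] M where
  toFun p := p ⊲ m
  map_add' p q := add_lmul p q m
  map_smul' r p := smul_lmul r p m

def rAt (m : M) : 𝕆 →ₗ[ℝ] M where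
  toFun p := m ⊳ p
  map_add' p q := rmul_add p q m
  map_smul' r p := rmul_smul r p m

theorem lmul_zero (p : 𝕆) : p ⊲ (0 : M) = 0 := map_zero (L p)
theorem lmul_neg (p : 𝕆) (m : M) : p ⊲ (-m) = -(p ⊲ m) := map_neg (L p) m
theorem lmul_sub (p : 𝕆) (m n : M) : p ⊲ (m - n) = p ⊲ m - p ⊲ n := map_sub (L p) m n
theorem lmul_sum {ι : Type*} (s : Finset ι) (p : 𝕆) (f : ι → M) :
    p ⊲ (∑ i ∈ s, f i) = ∑ i ∈ s, p ⊲ f i := map_sum (L p) f s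
theorem zero_rmul (p : 𝕆) : (0 : M) ⊳ p = 0 := map_zero (R p)
theorem neg_rmul (p : 𝕆) (m : M) : (-m) ⊳ p = -(m ⊳ p) := map_neg (R p) m
theorem sub_rmul (p : 𝕆) (m n : M) : (m - n) ⊳ p = m ⊳ p - n ⊳ p := map_sub (R p) m n
theorem sum_rmul {ι : Type*} (s : Finset ι) (p : 𝕆) (f : ι → M) :
    (∑ i ∈ s, f i) ⊳ p = ∑ i ∈ s, f i ⊳ p := map_sum (R p) f s
theorem zero_lmul (m : M) : (0 : 𝕆) ⊲ m = 0 := map_zero (lAt m)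
theorem neg_lmul (p : 𝕆) (m : M) : (-p) ⊲ m = -(p ⊲ m) := map_neg (lAt m) p
theorem sub_lmul (p q : 𝕆) (m : M) : (p - q) ⊲ m = p ⊲ m - q ⊲ m := map_sub (lAt m) p q
theorem rmul_neg (p : 𝕆) (m : M) : m ⊳ (-p) = -(m ⊳ p) := map_neg (rAt m) p
theorem rmul_sub (p q : 𝕆) (m : M) : m ⊳ (p - q) = m ⊳ p - m ⊳ q := map_sub (rAt m) p q

theorem L_neg (p : 𝕆) : (L (-p) : Module.End ℝ M) = - L p := by
  ext m; exact neg_lmul p m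
theorem R_neg (p : 𝕆) : (R (-p) : Module.End ℝ M) = - R p := by
  ext m; exact map_neg (rAt m) p
theorem L_e0 : (L (e 0) : Module.End ℝ M) = 1 := by
  ext m; exact one_lmul m
theorem R_e0 : (R (e 0) : Module.End ℝ M) = 1 := by
  ext m; exact rmul_one m

theorem LL (p q : 𝕆) : (L p * L q : Module.End ℝ M) + L q * L p = L (p * q) + L (q * p) := by
  ext m
  have := assoc_left_alt p q m
  simp only [LinearMap.add_apply, Module.End.mul_apply]
  change p ⊲ q ⊲ m + q ⊲ p ⊲ m = (p * q) ⊲ m + (q * p) ⊲ m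
  linear_combination (norm := module) -this
theorem RR (p q : 𝕆) : (R q * R p : Module.End ℝ M) = R (p * q) + L (p * q) - L p * L q := by
  ext m
  have := assoc_left_eq_right p q m
  change m ⊳ p ⊳ q = m ⊳ (p * q) + (p * q) ⊲ m - p ⊲ q ⊲ m
  linear_combination (norm := module) -this
theorem RL (p q : 𝕆) : (R p * L q : Module.End ℝ M) = L q * R p + L (p * q) - L p * L q := by
  ext m
  have := assoc_left_eq_middle p q m
  change (q ⊲ m) ⊳ p = q ⊲ (m ⊳ p) + (p * q) ⊲ m - p ⊲ q ⊲ m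
  linear_combination (norm := module) -this

theorem L_sq (i : Fin 8) (hi : 0 < i) : (L (e i) * L (e i) : Module.End ℝ M) = -1 := by
  have h := LL (M := M) (e i) (e i)
  have h2 := e_mul_self i hi
  rw [h2, L_neg, L_e0] at h
  have h3 : (2 : ℝ) • (L (e i) * L (e i) : Module.End ℝ M) = (2 : ℝ) • (-1) := by
    rw [two_smul, two_smul, h]
  exact smul_right_injective _ (two_ne_zero) h3

theorem L_anti (i j : Fin 8) (hj : 0 < j) (hi : j < i) :
    (L (e i) * L (e j) : Module.End ℝ M) = -(L (e j) * L (e i)) := by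
  have h := LL (M := M) (e i) (e j)
  have h2 := e_mul_anti i j hj hi
  rw [h2, L_neg, neg_add_cancel] at h
  exact eq_neg_of_add_eq_zero_left h

theorem key' {a b c : 𝕆} (hcc : c * c = -e 0) (hbc : b * c = a) (hac : a * c = -b)
    (hca : c * a = b) (hcb : c * b = -a) :
    ((L a - L b * L c) * (R c + L c) : Module.End ℝ M) = 0 := by
  have a1 := LL (M := M) c c
  have a2 := LL (M := M) c b
  have a3 := LL (M := M) c a
  have b0 := RR (M := M) c c
  have b1 := RR (M := M) b c
  have b2 := RR (M := M) a c
  have b3 := RL (M := M) c a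
  have b4 := RL (M := M) c b
  have b5 := RL (M := M) c c
  rw [hcc, L_neg, L_e0] at a1
  rw [hcb, hbc, L_neg, neg_add_cancel] at a2
  rw [hca, hac, L_neg, add_neg_cancel] at a3
  have a1' : (L c * L c : Module.End ℝ M) = -1 := by
    have h3 : (2 : ℝ) • (L c * L c : Module.End ℝ M) = (2 : ℝ) • (-1) := by
      rw [two_smul, two_smul, a1]
    exact smul_right_injective _ (two_ne_zero) h3
  rw [hcc, R_neg, L_neg, R_e0, L_e0, a1'] at b0
  rw [hbc] at b1
  rw [hac, R_neg, L_neg] at b2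
  rw [hca] at b3
  rw [hcb, L_neg] at b4
  rw [hcc, L_neg, L_e0, a1'] at b5
  refine key (R1 := R a) (R2 := R b) ?_ b1 ?_ b3 ?_ (eq_neg_of_add_eq_zero_left a2) ?_
  · rw [b0]; simp
  · rw [b2, eq_neg_of_add_eq_zero_left a3]; abel
  · rw [b4]; abel
  · rw [b5]; simp

theorem L_omega : (L (e 1) * (L (e 2) * (L (e 3) * (L (e 4) * (L (e 5) * (L (e 6) * L (e 7)))))) :
    Module.End ℝ M) = 1 := by
  refine omega (fun i => (L (e i) : Module.End ℝ M)) L_sq L_anti (R1 := R (e 1)) ?_ ?_ ?_ ?_ ?_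
  · refine key' ?_ ?_ ?_ ?_ ?_ <;> (rw [e_mul_e]; simp [sgn, idx])
  · refine key' ?_ ?_ ?_ ?_ ?_ <;> (rw [e_mul_e]; simp [sgn, idx])
  · refine key' ?_ ?_ ?_ ?_ ?_ <;> (rw [e_mul_e]; simp [sgn, idx])
  · have := RL (M := M) (e 1) (e 2)
    rw [e_mul_e] at this
    simpa [sgn, idx] using this
  · intro x hx
    have : (2 : ℝ) • x = 0 := by rw [two_smul, hx]
    simpa using this

theorem L_ne_anti (i j : Fin 8) (hi : 0 < i) (hj : 0 < j) (hij : i ≠ j) (y : M) :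
    e i ⊲ e j ⊲ y = -(e j ⊲ e i ⊲ y) := by
  rcases lt_or_gt_of_ne hij with h | h
  · have := congrArg (fun f => f y) (L_anti (M := M) j i hi h)
    change e j ⊲ e i ⊲ y = -(e i ⊲ e j ⊲ y) at this
    rw [this, neg_neg]
  · exact congrArg (fun f => f y) (L_anti (M := M) i j hj h)

theorem L_L_self (i : Fin 8) (hi : 0 < i) (y : M) : e i ⊲ e i ⊲ y = -y :=
  congrArg (fun f => f y) (L_sq (M := M) i hi)

theorem line_pairs (i j k : Fin 8) (hi : 0 < i) (hj : 0 < j) (hk : 0 < k) (hij : i ≠ j)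
    (hjk : j ≠ k) (hik : i ≠ k) {y : M} (h : e i ⊲ e j ⊲ e k ⊲ y = -y) :
    (e i ⊲ e j ⊲ y = e k ⊲ y ∧ e j ⊲ e i ⊲ y = -(e k ⊲ y)) ∧
    (e j ⊲ e k ⊲ y = e i ⊲ y ∧ e k ⊲ e j ⊲ y = -(e i ⊲ y)) ∧
    (e k ⊲ e i ⊲ y = e j ⊲ y ∧ e i ⊲ e k ⊲ y = -(e j ⊲ y)) := by
  have key : ∀ i j k : Fin 8, 0 < i → 0 < j → 0 < k → i ≠ j → j ≠ k → i ≠ k →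
      e i ⊲ e j ⊲ e k ⊲ y = -y → e j ⊲ e k ⊲ y = e i ⊲ y ∧ e k ⊲ e j ⊲ y = -(e i ⊲ y) := by
    intro i j k hi hj hk hij hjk hik h
    have h1 : e j ⊲ e k ⊲ y = e i ⊲ y := by
      have := congrArg (fun z => e i ⊲ z) h
      simp only [L_L_self i hi, lmul_neg] at this
      exact neg_injective this
    exact ⟨h1, by rw [L_ne_anti k j hk hj hjk.symm, h1]⟩
  have rot : ∀ i j k : Fin 8, 0 < i → 0 < j → 0 < k → i ≠ j → j ≠ k → i ≠ k →
      e i ⊲ e j ⊲ e k ⊲ y = -y → e j ⊲ e k ⊲ e i ⊲ y = -y := by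
    intro i j k hi hj hk hij hjk hik h
    rw [L_ne_anti k i hk hi hik.symm, lmul_neg, L_ne_anti j i hj hi hij.symm, neg_neg, h]
  have h2 := rot i j k hi hj hk hij hjk hik h
  have h3 := rot j k i hj hk hi hjk hik.symm hij.symm h2
  exact ⟨key k i j hk hi hj hik.symm hij hjk.symm h3, key i j k hi hj hk hij hjk hik h,
    key j k i hj hk hi hjk hik.symm hij.symm h2⟩

variable (M) in
/-- The nucleus of `M`: the associative elements. -/
def nucleus : Submodule ℝ M where
  carrier := {m | ∀ p q : 𝕆, (p * q) ⊲ m - p ⊲ q ⊲ m = 0}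
  zero_mem' := by intro p q; simp [lmul_zero]
  add_mem' := by
    intro a b ha hb p q
    have h1 := ha p q
    have h2 := hb p q
    rw [lmul_add, lmul_add, lmul_add]
    linear_combination (norm := module) h1 + h2
  smul_mem' := by
    intro c a ha p q
    have h1 := ha p q
    rw [lmul_smul, lmul_smul, lmul_smul, ← smul_sub, h1, smul_zero]

theorem nuc_left {m : M} (h : m ∈ nucleus M) (p q : 𝕆) : p ⊲ q ⊲ m = (p * q) ⊲ m :=
  (sub_eq_zero.mp (h p q)).symm

theorem mem_nucleus_of_basis {y : M} (h : ∀ i j, (e i * e j) ⊲ y = e i ⊲ e j ⊲ y) :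
    y ∈ nucleus M := by
  intro p q
  have h1 : ∀ i, (e i * q) ⊲ y = e i ⊲ q ⊲ y := by
    intro i
    refine linear_ext
      { toFun := fun q => (e i * q) ⊲ y, map_add' := ?_, map_smul' := ?_ }
      (L (e i) ∘ₗ lAt y) ?_ q
    · intro a b; rw [Octonion.mul_add, add_lmul]
    · intro r a; rw [Octonion.mul_smul, smul_lmul]; rfl
    · intro j; exact h i j
  rw [sub_eq_zero]
  refine linear_ext
      { toFun := fun p => (p * q) ⊲ y, map_add' := ?_, map_smul' := ?_ }
      (lAt (q ⊲ y)) ?_ p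
  · intro a b; rw [Octonion.add_mul, add_lmul]
  · intro r a; rw [Octonion.smul_mul, smul_lmul]; rfl
  · intro j; exact h1 j

theorem mem_nucleus_of_lines {y : M} (ha : e 1 ⊲ e 2 ⊲ e 3 ⊲ y = -y)
    (hb : e 1 ⊲ e 4 ⊲ e 5 ⊲ y = -y) (hd : e 2 ⊲ e 4 ⊲ e 6 ⊲ y = -y) : y ∈ nucleus M := by
  obtain ⟨c1, c2, c3, c4⟩ := lines_of_three (fun i => (L (e i) : Module.End ℝ M)) L_sq L_anti L_omega
  have hc : e 1 ⊲ e 6 ⊲ e 7 ⊲ y = -y := by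
    have := congrArg (fun f => f y) c1
    change e 1 ⊲ e 6 ⊲ e 7 ⊲ y = -(e 1 ⊲ e 2 ⊲ e 3 ⊲ e 1 ⊲ e 4 ⊲ e 5 ⊲ y) at this
    rw [this, hb]; simp only [lmul_neg, ha, neg_neg]
  have he : e 2 ⊲ e 7 ⊲ e 5 ⊲ y = -y := by
    have := congrArg (fun f => f y) c2
    change e 2 ⊲ e 7 ⊲ e 5 ⊲ y = -(e 1 ⊲ e 2 ⊲ e 3 ⊲ e 2 ⊲ e 4 ⊲ e 6 ⊲ y) at this
    rw [this, hd]; simp only [lmul_neg, ha, neg_neg]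
  have hf : e 3 ⊲ e 7 ⊲ e 4 ⊲ y = -y := by
    have := congrArg (fun f => f y) c3
    change e 3 ⊲ e 7 ⊲ e 4 ⊲ y = -(e 1 ⊲ e 4 ⊲ e 5 ⊲ e 2 ⊲ e 4 ⊲ e 6 ⊲ y) at this
    rw [this, hd]; simp only [lmul_neg, hb, neg_neg]
  have hg : e 3 ⊲ e 6 ⊲ e 5 ⊲ y = -y := by
    have := congrArg (fun f => f y) c4
    change e 3 ⊲ e 6 ⊲ e 5 ⊲ y =
      (e 1 ⊲ e 2 ⊲ e 3 ⊲ e 1 ⊲ e 4 ⊲ e 5 ⊲ e 2 ⊲ e 4 ⊲ e 6 ⊲ y) at this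
    rw [this, hd]; simp only [lmul_neg, hb, ha, neg_neg]
  have pa := line_pairs 1 2 3 (by decide) (by decide) (by decide) (by decide) (by decide) (by decide) ha
  have pb := line_pairs 1 4 5 (by decide) (by decide) (by decide) (by decide) (by decide) (by decide) hb
  have pc := line_pairs 1 6 7 (by decide) (by decide) (by decide) (by decide) (by decide) (by decide) hc
  have pd := line_pairs 2 4 6 (by decide) (by decide) (by decide) (by decide) (by decide) (by decide) hd
  have pe := line_pairs 2 7 5 (by decide) (by decide) (by decide) (by decide) (by decide) (by decide) he
  have pf := line_pairs 3 7 4 (by decide) (by decide) (by decide) (by decide) (by decide) (by decide) hf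
  have pg := line_pairs 3 6 5 (by decide) (by decide) (by decide) (by decide) (by decide) (by decide) hg
  have hz : ∀ z : M, e 0 ⊲ z = z := one_lmul
  apply mem_nucleus_of_basis
  intro i j
  rw [e_mul_e]
  fin_cases i <;> fin_cases j <;>
    simp [sgn, idx, hz, smul_lmul, neg_lmul, L_L_self, pa, pb, pc, pd, pe, pf, pg]

theorem lines_of_mem_nucleus {y : M} (h : y ∈ nucleus M) : e 1 ⊲ e 2 ⊲ e 3 ⊲ y = -y ∧
    e 1 ⊲ e 4 ⊲ e 5 ⊲ y = -y ∧ e 2 ⊲ e 4 ⊲ e 6 ⊲ y = -y := by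
  refine ⟨?_, ?_, ?_⟩ <;>
  · rw [nuc_left h, e_mul_e]
    simp [sgn, idx, L_L_self]

variable (M) in
noncomputable def proj : Module.End ℝ M :=
  (1 / 8 : ℝ) • ((1 - L (e 1) * L (e 2) * L (e 3)) * (1 - L (e 1) * L (e 4) * L (e 5)) *
    (1 - L (e 2) * L (e 4) * L (e 6)))

theorem L_line_sq (i j k : Fin 8) (hi : 0 < i) (hj : i < j) (hk : j < k) :
    (-(L (e i) * L (e j) * L (e k)) * -(L (e i) * L (e j) * L (e k)) : Module.End ℝ M) = 1 := by
  have hs := sq' (fun i => (L (e i) : Module.End ℝ M)) L_sq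
  have ha := anti' (fun i => (L (e i) : Module.End ℝ M)) L_anti
  simp [mul_assoc, ha, hs, L_sq, L_anti, hi, hj, hk, hi.trans hj, (hi.trans hj).trans hk, hj.trans hk]

theorem proj_mem (x : M) : proj M x ∈ nucleus M := by
  have hs := sq' (fun i => (L (e i) : Module.End ℝ M)) L_sq
  have ha := anti' (fun i => (L (e i) : Module.End ℝ M)) L_anti
  obtain ⟨h1, h2, h3⟩ := average_fixed (A := Module.End ℝ M)
    (a := -(L (e 1) * L (e 2) * L (e 3))) (b := -(L (e 1) * L (e 4) * L (e 5)))
    (d := -(L (e 2) * L (e 4) * L (e 6)))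
    (L_line_sq _ _ _ (by decide) (by decide) (by decide))
    (L_line_sq _ _ _ (by decide) (by decide) (by decide))
    (L_line_sq _ _ _ (by decide) (by decide) (by decide))
    (by simp [mul_assoc, ha, hs, L_sq, L_anti]) (by simp [mul_assoc, ha, hs, L_sq, L_anti])
    (by simp [mul_assoc, ha, hs, L_sq, L_anti])
  simp only [← sub_eq_add_neg] at h1 h2 h3
  have g : ∀ i j k : Fin 8, -(L (e i) * L (e j) * L (e k) : Module.End ℝ M) * ((1 - L (e 1) * L (e 2) * L (e 3)) * (1 - L (e 1) * L (e 4) * L (e 5)) *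
    (1 - L (e 2) * L (e 4) * L (e 6))) = ((1 - L (e 1) * L (e 2) * L (e 3)) * (1 - L (e 1) * L (e 4) * L (e 5)) *
    (1 - L (e 2) * L (e 4) * L (e 6))) → e i ⊲ e j ⊲ e k ⊲ proj M x = -proj M x := by
    intro i j k h
    have h' : -(L (e i) * L (e j) * L (e k)) * proj M = proj M := by
      rw [proj, mul_smul_comm, h]
    have := congrArg (fun f => f x) h'
    change -(e i ⊲ e j ⊲ e k ⊲ proj M x) = proj M x at this
    rw [← this, neg_neg, this]
  exact mem_nucleus_of_lines (g _ _ _ h1) (g _ _ _ h2) (g _ _ _ h3)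


theorem conj_prod {A : Type*} [Ring A] {l a b d : A} (sa sb sd : ℤ) (hl : l * l = -1)
    (ha : l * a = sa • (a * l)) (hb : l * b = sb • (b * l)) (hd : l * d = sd • (d * l)) :
    l * ((1 - a) * (1 - b) * (1 - d)) * l = -((1 - sa • a) * (1 - sb • b) * (1 - sd • d)) := by
  have h : ∀ (s : ℤ) (x : A), l * x = s • (x * l) → l * (1 - x) = (1 - s • x) * l := by
    intro s x hx; rw [mul_sub, hx, sub_mul, smul_mul_assoc, mul_one, one_mul]
  calc l * ((1 - a) * (1 - b) * (1 - d)) * l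
      = (l * (1 - a)) * (1 - b) * (1 - d) * l := by simp only [mul_assoc]
    _ = (1 - sa • a) * (l * (1 - b)) * (1 - d) * l := by rw [h sa a ha]; simp only [mul_assoc]
    _ = (1 - sa • a) * (1 - sb • b) * (l * (1 - d)) * l := by
      rw [h sb b hb]; simp only [mul_assoc]
    _ = (1 - sa • a) * (1 - sb • b) * (1 - sd • d) * (l * l) := by
      rw [h sd d hd]; simp only [mul_assoc]
    _ = _ := by rw [hl]; simp

variable (M) in
theorem sum_proj : proj M - (L (e 1) * proj M * L (e 1) + L (e 2) * proj M * L (e 2) +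
    L (e 3) * proj M * L (e 3) + L (e 4) * proj M * L (e 4) + L (e 5) * proj M * L (e 5) +
    L (e 6) * proj M * L (e 6) + L (e 7) * proj M * L (e 7)) = 1 := by
  have hs := sq' (fun i => (L (e i) : Module.End ℝ M)) L_sq
  have ha := anti' (fun i => (L (e i) : Module.End ℝ M)) L_anti
  have c1 := conj_prod 1 1 (-1) (L_sq (M := M) 1 (by decide))
    (a := L (e 1) * L (e 2) * L (e 3)) (b := L (e 1) * L (e 4) * L (e 5))
    (d := L (e 2) * L (e 4) * L (e 6)) (by simp [mul_assoc, ha, hs, L_sq, L_anti])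
    (by simp [mul_assoc, ha, hs, L_sq, L_anti]) (by simp [mul_assoc, ha, hs, L_sq, L_anti])
  have c2 := conj_prod 1 (-1) 1 (L_sq (M := M) 2 (by decide))
    (a := L (e 1) * L (e 2) * L (e 3)) (b := L (e 1) * L (e 4) * L (e 5))
    (d := L (e 2) * L (e 4) * L (e 6)) (by simp [mul_assoc, ha, hs, L_sq, L_anti])
    (by simp [mul_assoc, ha, hs, L_sq, L_anti]) (by simp [mul_assoc, ha, hs, L_sq, L_anti])
  have c3 := conj_prod 1 (-1) (-1) (L_sq (M := M) 3 (by decide))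
    (a := L (e 1) * L (e 2) * L (e 3)) (b := L (e 1) * L (e 4) * L (e 5))
    (d := L (e 2) * L (e 4) * L (e 6)) (by simp [mul_assoc, ha, hs, L_sq, L_anti])
    (by simp [mul_assoc, ha, hs, L_sq, L_anti]) (by simp [mul_assoc, ha, hs, L_sq, L_anti])
  have c4 := conj_prod (-1) 1 1 (L_sq (M := M) 4 (by decide))
    (a := L (e 1) * L (e 2) * L (e 3)) (b := L (e 1) * L (e 4) * L (e 5))
    (d := L (e 2) * L (e 4) * L (e 6)) (by simp [mul_assoc, ha, hs, L_sq, L_anti])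
    (by simp [mul_assoc, ha, hs, L_sq, L_anti]) (by simp [mul_assoc, ha, hs, L_sq, L_anti])
  have c5 := conj_prod (-1) 1 (-1) (L_sq (M := M) 5 (by decide))
    (a := L (e 1) * L (e 2) * L (e 3)) (b := L (e 1) * L (e 4) * L (e 5))
    (d := L (e 2) * L (e 4) * L (e 6)) (by simp [mul_assoc, ha, hs, L_sq, L_anti])
    (by simp [mul_assoc, ha, hs, L_sq, L_anti]) (by simp [mul_assoc, ha, hs, L_sq, L_anti])
  have c6 := conj_prod (-1) (-1) 1 (L_sq (M := M) 6 (by decide))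
    (a := L (e 1) * L (e 2) * L (e 3)) (b := L (e 1) * L (e 4) * L (e 5))
    (d := L (e 2) * L (e 4) * L (e 6)) (by simp [mul_assoc, ha, hs, L_sq, L_anti])
    (by simp [mul_assoc, ha, hs, L_sq, L_anti]) (by simp [mul_assoc, ha, hs, L_sq, L_anti])
  have c7 := conj_prod (-1) (-1) (-1) (L_sq (M := M) 7 (by decide))
    (a := L (e 1) * L (e 2) * L (e 3)) (b := L (e 1) * L (e 4) * L (e 5))
    (d := L (e 2) * L (e 4) * L (e 6)) (by simp [mul_assoc, ha, hs, L_sq, L_anti])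
    (by simp [mul_assoc, ha, hs, L_sq, L_anti]) (by simp [mul_assoc, ha, hs, L_sq, L_anti])
  simp only [proj, mul_smul_comm, smul_mul_assoc, c1, c2, c3, c4, c5, c6, c7, one_smul, neg_smul,
    sub_neg_eq_add]
  generalize (L (e 1) * L (e 2) * L (e 3) : Module.End ℝ M) = a
  generalize (L (e 1) * L (e 4) * L (e 5) : Module.End ℝ M) = b
  generalize (L (e 2) * L (e 4) * L (e 6) : Module.End ℝ M) = d
  simp only [← smul_add, ← smul_sub]
  have : ∀ z : Module.End ℝ M, z = (8 : ℤ) • 1 → (1 / 8 : ℝ) • z = 1 := by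
    rintro z rfl
    rw [← Int.cast_smul_eq_zsmul ℝ, smul_smul]; norm_num
  apply this
  noncomm_ring

theorem proj_of_lines {z : M} {sa sb sd : ℝ} (ha : e 1 ⊲ e 2 ⊲ e 3 ⊲ z = sa • z)
    (hb : e 1 ⊲ e 4 ⊲ e 5 ⊲ z = sb • z) (hd : e 2 ⊲ e 4 ⊲ e 6 ⊲ z = sd • z) :
    proj M z = ((1 - sa) * (1 - sb) * (1 - sd) / 8) • z := by
  have hA : (L (e 1) * L (e 2) * L (e 3) : Module.End ℝ M) z = sa • z := ha
  have hB : (L (e 1) * L (e 4) * L (e 5) : Module.End ℝ M) z = sb • z := hb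
  have hD : (L (e 2) * L (e 4) * L (e 6) : Module.End ℝ M) z = sd • z := hd
  have h : proj M z = (1 / 8 : ℝ) • ((1 - L (e 1) * L (e 2) * L (e 3) : Module.End ℝ M)
      ((1 - L (e 1) * L (e 4) * L (e 5) : Module.End ℝ M)
        ((1 - L (e 2) * L (e 4) * L (e 6) : Module.End ℝ M) z))) := rfl
  have g : ∀ (f : Module.End ℝ M) (s t : ℝ), f z = s • z →
      (1 - f) (t • z) = ((1 - s) * t) • z := by
    intro f s t hf
    rw [map_smul, LinearMap.sub_apply, hf, Module.End.one_apply]; module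
  have g1 := g _ sd 1 hD
  rw [one_smul] at g1
  rw [h, g1, g _ sb _ hB, g _ sa _ hA]
  module

theorem proj_lmul {c : M} (h : c ∈ nucleus M) (p : 𝕆) : proj M (p ⊲ c) = p 0 • c := by
  refine linear_ext (proj M ∘ₗ lAt c)
    { toFun := fun p => p 0 • c, map_add' := ?_, map_smul' := ?_ } ?_ p
  · intro p q; rw [Octonion.add_apply, add_smul]
  · intro r p; rw [Octonion.smul_apply, mul_smul]; rfl
  · intro i
    change proj M (e i ⊲ c) = e i 0 • c
    have hz : ∀ z : M, e 0 ⊲ z = z := one_lmul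
    have n := fun p q => nuc_left h p q
    fin_cases i
    · rw [proj_of_lines (sa := -1) (sb := -1) (sd := -1)] <;>
        simp [hz, n, e_mul_e, sgn, idx, smul_lmul, neg_lmul, lmul_neg, e_apply] <;> norm_num
    · rw [proj_of_lines (sa := -1) (sb := -1) (sd := 1)] <;>
        simp [hz, n, e_mul_e, sgn, idx, smul_lmul, neg_lmul, lmul_neg, e_apply]
    · rw [proj_of_lines (sa := -1) (sb := 1) (sd := -1)] <;>
        simp [hz, n, e_mul_e, sgn, idx, smul_lmul, neg_lmul, lmul_neg, e_apply]
    · rw [proj_of_lines (sa := -1) (sb := 1) (sd := 1)] <;>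
        simp [hz, n, e_mul_e, sgn, idx, smul_lmul, neg_lmul, lmul_neg, e_apply]
    · rw [proj_of_lines (sa := 1) (sb := -1) (sd := -1)] <;>
        simp [hz, n, e_mul_e, sgn, idx, smul_lmul, neg_lmul, lmul_neg, e_apply]
    · rw [proj_of_lines (sa := 1) (sb := -1) (sd := 1)] <;>
        simp [hz, n, e_mul_e, sgn, idx, smul_lmul, neg_lmul, lmul_neg, e_apply]
    · rw [proj_of_lines (sa := 1) (sb := 1) (sd := -1)] <;>
        simp [hz, n, e_mul_e, sgn, idx, smul_lmul, neg_lmul, lmul_neg, e_apply]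
    · rw [proj_of_lines (sa := 1) (sb := 1) (sd := 1)] <;>
        simp [hz, n, e_mul_e, sgn, idx, smul_lmul, neg_lmul, lmul_neg, e_apply]

/-- `M = ∑ i, e i ⊲ nucleus M`. -/
theorem exists_decomposition (x : M) :
    ∃ c : Fin 8 → M, (∀ i, c i ∈ nucleus M) ∧ x = ∑ i, e i ⊲ c i := by
  refine ⟨fun i => if i = 0 then proj M x else - proj M (e i ⊲ x), ?_, ?_⟩
  · intro i
    by_cases hi : i = 0
    · simpa [hi] using proj_mem x
    · simpa [hi] using proj_mem (e i ⊲ x)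
  · have := congrArg (fun f => f x) (sum_proj M)
    change proj M x - (e 1 ⊲ proj M (e 1 ⊲ x) + e 2 ⊲ proj M (e 2 ⊲ x) + e 3 ⊲ proj M (e 3 ⊲ x) +
      e 4 ⊲ proj M (e 4 ⊲ x) + e 5 ⊲ proj M (e 5 ⊲ x) + e 6 ⊲ proj M (e 6 ⊲ x) +
      e 7 ⊲ proj M (e 7 ⊲ x)) = x at this
    have hz : ∀ z : M, e 0 ⊲ z = z := one_lmul
    rw [Fin.sum_univ_eight]
    simp [lmul_neg, hz]
    nth_rewrite 1 [← this]
    abel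

/-- The decomposition is direct. -/
theorem decomposition_zero {x : M} {c : Fin 8 → M} (hc : ∀ i, c i ∈ nucleus M)
    (hx : x = ∑ i, e i ⊲ c i) : c 0 = proj M x := by
  rw [hx, map_sum, Finset.sum_congr rfl (fun i _ => proj_lmul (hc i) (e i))]
  simp [e_apply]

/-- The real part operator: the projection of `M = ⨁ i, e i ⊲ nucleus M` onto the summand
`e 0 ⊲ nucleus M = nucleus M`. -/
noncomputable def re (x : M) : M := Classical.choose (exists_decomposition x) 0

theorem re_eq_proj (x : M) : re x = proj M x := by
  obtain ⟨h1, h2⟩ := Classical.choose_spec (exists_decomposition x)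
  exact decomposition_zero h1 h2

theorem nuc_right {m : M} (h : m ∈ nucleus M) (p q : 𝕆) : m ⊳ p ⊳ q = m ⊳ (p * q) := by
  have h1 := assoc_left_eq_right p q m
  rw [nuc_left h, sub_self] at h1
  exact (sub_eq_zero.mp h1.symm)

theorem nuc_mid {m : M} (h : m ∈ nucleus M) (p q : 𝕆) : (q ⊲ m) ⊳ p = q ⊲ (m ⊳ p) := by
  have h1 := assoc_left_eq_middle p q m
  rw [nuc_left h, sub_self] at h1
  exact (sub_eq_zero.mp h1.symm)

theorem nuc_comm_assoc {m : M} (h : m ∈ nucleus M) (a b c : 𝕆) :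
    ((a * b) * c - a * (b * c)) ⊲ m = m ⊳ ((a * b) * c - a * (b * c)) := by
  have h1 := assoc_left_eq_middle a b (c ⊲ m)
  have h2 := assoc_left_eq_right b c (m ⊳ a)
  rw [nuc_left h, nuc_left h, nuc_left h, nuc_mid h, nuc_mid h] at h1
  rw [nuc_right h, nuc_right h, nuc_right h] at h2
  rw [sub_lmul, rmul_sub, h1, h2]

/-- Associative elements commute with all octonions. -/
theorem nuc_comm {m : M} (h : m ∈ nucleus M) (p : 𝕆) : p ⊲ m = m ⊳ p := by
  refine linear_ext (lAt m) (rAt m) ?_ p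
  intro i
  change e i ⊲ m = m ⊳ e i
  by_cases hi : i = 0
  · subst hi; exact (one_lmul m).trans (rmul_one m).symm
  have key : ∀ a b c k : Fin 8, (e a * e b) * e c = e k → e a * (e b * e c) = - e k →
      e k ⊲ m = m ⊳ e k := by
    intro a b c k h1 h2
    have := nuc_comm_assoc h (e a) (e b) (e c)
    rw [h1, h2, sub_neg_eq_add, add_lmul, rmul_add, ← two_smul ℝ, ← two_smul ℝ (m ⊳ e k)] at this
    exact smul_right_injective _ (two_ne_zero) this
  fin_cases i
  · exact absurd rfl hi
  · exact key 2 4 7 1 (by simp [e_mul_e, sgn, idx, neg_mul', mul_neg']) (by simp [e_mul_e, sgn, idx, neg_mul', mul_neg'])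
  · exact key 1 6 5 2 (by simp [e_mul_e, sgn, idx, neg_mul', mul_neg'])
      (by simp [e_mul_e, sgn, idx, neg_mul', mul_neg'])
  · exact key 1 5 7 3 (by simp [e_mul_e, sgn, idx, neg_mul', mul_neg']) (by simp [e_mul_e, sgn, idx, neg_mul', mul_neg'])
  · exact key 1 2 7 4 (by simp [e_mul_e, sgn, idx, neg_mul', mul_neg']) (by simp [e_mul_e, sgn, idx, neg_mul', mul_neg'])
  · exact key 1 2 6 5 (by simp [e_mul_e, sgn, idx, neg_mul', mul_neg']) (by simp [e_mul_e, sgn, idx, neg_mul', mul_neg'])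
  · exact key 1 4 3 6 (by simp [e_mul_e, sgn, idx, neg_mul', mul_neg']) (by simp [e_mul_e, sgn, idx, neg_mul', mul_neg'])
  · exact key 1 3 5 7 (by simp [e_mul_e, sgn, idx, neg_mul', mul_neg']) (by simp [e_mul_e, sgn, idx, neg_mul', mul_neg'])

theorem re_mem (x : M) : re x ∈ nucleus M := by rw [re_eq_proj]; exact proj_mem x
theorem re_zero : re (0 : M) = 0 := by rw [re_eq_proj, map_zero]
theorem re_add (x y : M) : re (x + y) = re x + re y := by simp only [re_eq_proj, map_add]
theorem re_sub (x y : M) : re (x - y) = re x - re y := by simp only [re_eq_proj, map_sub]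
theorem re_neg (x : M) : re (-x) = -re x := by simp only [re_eq_proj, map_neg]
theorem re_smul (r : ℝ) (x : M) : re (r • x) = r • re x := by simp only [re_eq_proj, map_smul]
theorem re_sum {ι : Type*} (s : Finset ι) (f : ι → M) :
    re (∑ i ∈ s, f i) = ∑ i ∈ s, re (f i) := by simp only [re_eq_proj, map_sum]
theorem re_lmul_nuc {c : M} (h : c ∈ nucleus M) (p : 𝕆) : re (p ⊲ c) = p 0 • c := by
  rw [re_eq_proj, proj_lmul h]

/-- Induction on the decomposition of `M` into multiples of associative elements. -/
theorem nuc_induction {P : M → Prop} (hadd : ∀ x y, P x → P y → P (x + y)) (h0 : P 0)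
    (h : ∀ (p : 𝕆) (c : M), c ∈ nucleus M → P (p ⊲ c)) (x : M) : P x := by
  obtain ⟨c, hc, rfl⟩ := exists_decomposition x
  exact Finset.sum_induction _ P hadd h0 (fun i _ => h (e i) (c i) (hc i))

theorem re_assoc (p q : 𝕆) (x : M) : re ((p * q) ⊲ x) = re (p ⊲ q ⊲ x) := by
  refine nuc_induction (P := fun x => re ((p * q) ⊲ x) = re (p ⊲ q ⊲ x)) ?_ ?_ ?_ x
  · intro x y hx hy; simp only [lmul_add, re_add, hx, hy]
  · simp only [lmul_zero]
  · intro r c hc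
    simp only [nuc_left hc, re_lmul_nuc hc, Octonion.assoc_re]

theorem re_comm (p : 𝕆) (x : M) : re (p ⊲ x) = re (x ⊳ p) := by
  refine nuc_induction (P := fun x => re (p ⊲ x) = re (x ⊳ p)) ?_ ?_ ?_ x
  · intro x y hx hy; simp only [lmul_add, add_rmul, re_add, hx, hy]
  · simp only [lmul_zero, zero_rmul]
  · intro r c hc
    rw [nuc_mid hc, ← nuc_comm hc, nuc_left hc, nuc_left hc, re_lmul_nuc hc, re_lmul_nuc hc,
      Octonion.comm_re]

theorem re_assoc_right (p q : 𝕆) (x : M) : re (x ⊳ (p * q)) = re (x ⊳ p ⊳ q) := by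
  have h := assoc_left_eq_right p q x
  have h2 := congrArg re h
  rw [re_sub, re_sub, re_assoc, sub_self] at h2
  exact (sub_eq_zero.mp h2.symm).symm

theorem eq_zero_of_re {x : M} (h : ∀ k, re (e k ⊲ x) = 0) : x = 0 := by
  obtain ⟨c, hc, rfl⟩ := exists_decomposition x
  refine Finset.sum_eq_zero fun k _ => ?_
  have h1 := h k
  rw [lmul_sum, re_sum, Finset.sum_eq_single k] at h1
  · rw [nuc_left (hc k), re_lmul_nuc (hc k), e_mul_e_zero, if_pos rfl] at h1
    have : c k = 0 := by
      by_cases hk : k = 0 <;> simpa [hk] using h1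
    rw [this, lmul_zero]
  · intro j _ hj
    rw [nuc_left (hc j), re_lmul_nuc (hc j), e_mul_e_zero, if_neg (Ne.symm hj), zero_smul]
  · intro h; exact absurd (Finset.mem_univ k) h

theorem eq_zero_of_re_right {x : M} (h : ∀ k, re (x ⊳ e k) = 0) : x = 0 :=
  eq_zero_of_re fun k => by rw [re_comm, h]
end basic

section hom
variable {M M' M'' : Type*} [AddCommGroup M] [Module ℝ M] [OctonionBimodule M]
  [AddCommGroup M'] [Module ℝ M'] [OctonionBimodule M']
  [AddCommGroup M''] [Module ℝ M''] [OctonionBimodule M'']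

/-- The second left associator `A_p(x, f) = f (p x) - p f(x)`. -/
def secondLeft (p : 𝕆) (x : M) (f : M →ₗ[ℝ] M') : M' := f (p ⊲ x) - p ⊲ f x

/-- The second right associator `B_p(f, x) = f(x) p - f (x p)`. -/
def secondRight (p : 𝕆) (f : M →ₗ[ℝ] M') (x : M) : M' := f x ⊳ p - f (x ⊳ p)

variable (M M') in
/-- `Hom_LO(M, M')`: the real vector space of left para-linear maps. -/
def HomLO : Submodule ℝ (M →ₗ[ℝ] M') where
  carrier := {f | ∀ (p : 𝕆) (x : M), re (secondLeft p x f) = 0}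
  zero_mem' := by
    intro p x; simp [secondLeft, lmul_zero, re_zero]
  add_mem' := by
    intro f g hf hg p x
    have h : secondLeft p x (f + g) = secondLeft p x f + secondLeft p x g := by
      simp only [secondLeft, LinearMap.add_apply, lmul_add]; abel
    rw [h, re_add, hf, hg, add_zero]
  smul_mem' := by
    intro r f hf p x
    have h : secondLeft p x (r • f) = r • secondLeft p x f := by
      simp only [secondLeft, LinearMap.smul_apply, lmul_smul, smul_sub]
    rw [h, re_smul, hf, smul_zero]

variable (M M') in
/-- `Hom_RO(M, M')`: the real vector space of right para-linear maps. -/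
def HomRO : Submodule ℝ (M →ₗ[ℝ] M') where
  carrier := {f | ∀ (p : 𝕆) (x : M), re (secondRight p f x) = 0}
  zero_mem' := by
    intro p x; simp [secondRight, zero_rmul, re_zero]
  add_mem' := by
    intro f g hf hg p x
    have h : secondRight p (f + g) x = secondRight p f x + secondRight p g x := by
      simp only [secondRight, LinearMap.add_apply, add_rmul]; abel
    rw [h, re_add, hf, hg, add_zero]
  smul_mem' := by
    intro r f hf p x
    have h : secondRight p (r • f) x = r • secondRight p f x := by
      simp only [secondRight, LinearMap.smul_apply, smul_rmul, smul_sub]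
    rw [h, re_smul, hf, smul_zero]

instance HomLO.addCommGroup : AddCommGroup (HomLO M M') := Submodule.addCommGroup _
instance HomLO.module : Module ℝ (HomLO M M') := Submodule.module _
instance HomRO.addCommGroup : AddCommGroup (HomRO M M') := Submodule.addCommGroup _
instance HomRO.module : Module ℝ (HomRO M M') := Submodule.module _

theorem mem_HomLO_iff {f : M →ₗ[ℝ] M'} :
    f ∈ HomLO M M' ↔ ∀ c ∈ nucleus M, ∀ p : 𝕆, f (p ⊲ c) = p ⊲ f c := by
  constructor
  · intro hf c hc p
    have hr : ∀ (q : 𝕆) (x : M), re (f (q ⊲ x)) = re (q ⊲ f x) := fun q x => by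
      have := hf q x
      rwa [secondLeft, re_sub, sub_eq_zero] at this
    refine sub_eq_zero.mp (eq_zero_of_re fun k => ?_)
    rw [lmul_sub, re_sub, ← hr, nuc_left hc, hr, re_assoc, sub_self]
  · intro hf p x
    refine nuc_induction (P := fun x => re (secondLeft p x f) = 0) ?_ ?_ ?_ x
    · intro x y hx hy
      have h : secondLeft p (x + y) f = secondLeft p x f + secondLeft p y f := by
        simp only [secondLeft, map_add, lmul_add]; abel
      rw [h, re_add, hx, hy, add_zero]
    · simp [secondLeft, lmul_zero, re_zero]
    · intro q c hc
      rw [secondLeft, nuc_left hc, hf c hc, hf c hc, re_sub, re_assoc, sub_self]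

theorem mem_HomRO_iff {f : M →ₗ[ℝ] M'} :
    f ∈ HomRO M M' ↔ ∀ c ∈ nucleus M, ∀ p : 𝕆, f (c ⊳ p) = f c ⊳ p := by
  constructor
  · intro hf c hc p
    have hr : ∀ (q : 𝕆) (x : M), re (f (x ⊳ q)) = re (f x ⊳ q) := fun q x => by
      have := hf q x
      rw [secondRight, re_sub, sub_eq_zero] at this
      exact this.symm
    refine sub_eq_zero.mp (eq_zero_of_re_right fun k => ?_)
    rw [sub_rmul, re_sub, ← hr, nuc_right hc, hr, re_assoc_right, sub_self]
  · intro hf p x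
    refine nuc_induction (P := fun x => re (secondRight p f x) = 0) ?_ ?_ ?_ x
    · intro x y hx hy
      have h : secondRight p f (x + y) = secondRight p f x + secondRight p f y := by
        simp only [secondRight, map_add, add_rmul]; abel
      rw [h, re_add, hx, hy, add_zero]
    · simp [secondRight, zero_rmul, re_zero]
    · intro q c hc
      rw [nuc_comm hc, secondRight, nuc_right hc, hf c hc, hf c hc, re_sub, re_assoc_right, sub_self]

/-- A left para-linear map is determined by its values on associative elements. -/
theorem HomLO_ext {f g : HomLO M M'} (h : ∀ c ∈ nucleus M, f.1 c = g.1 c) : f = g := by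
  refine Subtype.ext (LinearMap.ext fun x => ?_)
  refine nuc_induction (P := fun x => f.1 x = g.1 x) ?_ ?_ ?_ x
  · intro x y hx hy; rw [map_add, map_add, hx, hy]
  · rw [map_zero, map_zero]
  · intro p c hc
    rw [mem_HomLO_iff.mp f.2 c hc, mem_HomLO_iff.mp g.2 c hc, h c hc]

theorem HomRO_ext {f g : HomRO M M'} (h : ∀ c ∈ nucleus M, f.1 c = g.1 c) : f = g := by
  refine Subtype.ext (LinearMap.ext fun x => ?_)
  refine nuc_induction (P := fun x => f.1 x = g.1 x) ?_ ?_ ?_ x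
  · intro x y hx hy; rw [map_add, map_add, hx, hy]
  · rw [map_zero, map_zero]
  · intro p c hc
    rw [nuc_comm hc, mem_HomRO_iff.mp f.2 c hc, mem_HomRO_iff.mp g.2 c hc, h c hc]

theorem secondLeft_nuc (f : HomLO M M') {c : M} (hc : c ∈ nucleus M) (p : 𝕆) :
    secondLeft p c f.1 = 0 := by
  rw [secondLeft, mem_HomLO_iff.mp f.2 c hc, sub_self]

theorem secondRight_nuc (f : HomRO M M') {c : M} (hc : c ∈ nucleus M) (p : 𝕆) :
    secondRight p f.1 c = 0 := by
  rw [secondRight, mem_HomRO_iff.mp f.2 c hc, sub_self]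

/-- `(r ⊙ f)(x) = f(x r) + A_r(x, f)` for left para-linear `f`. -/
def HomLO.lsmul (r : 𝕆) (f : HomLO M M') : HomLO M M' :=
  ⟨{ toFun := fun x => f.1 (x ⊳ r) + secondLeft r x f.1
     map_add' := by
      intro x y; simp only [secondLeft, add_rmul, lmul_add, map_add]; abel
     map_smul' := by
      intro a x
      simp only [secondLeft, smul_rmul, lmul_smul, map_smul, smul_add, smul_sub, RingHom.id_apply] },
   by
    refine mem_HomLO_iff.mpr fun c hc p => ?_
    have hf := fun q => mem_HomLO_iff.mp f.2 c hc q
    change f.1 ((p ⊲ c) ⊳ r) + secondLeft r (p ⊲ c) f.1 = p ⊲ (f.1 (c ⊳ r) + secondLeft r c f.1)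
    rw [secondLeft_nuc f hc, add_zero, secondLeft, nuc_mid hc, ← nuc_comm hc, nuc_left hc,
      nuc_left hc, hf, hf, hf, hf]
    have h1 := assoc_left_alt p r (f.1 c)
    linear_combination (norm := module) h1⟩

/-- `(f ⊙ r)(x) = f(x) r - A_r(x, f)` for left para-linear `f`. -/
def HomLO.rsmul (f : HomLO M M') (r : 𝕆) : HomLO M M' :=
  ⟨{ toFun := fun x => f.1 x ⊳ r - secondLeft r x f.1
     map_add' := by
      intro x y; simp only [secondLeft, add_rmul, lmul_add, map_add]; abel
     map_smul' := by
      intro a x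
      simp only [secondLeft, smul_rmul, lmul_smul, map_smul, smul_sub, RingHom.id_apply] },
   by
    refine mem_HomLO_iff.mpr fun c hc p => ?_
    have hf := fun q => mem_HomLO_iff.mp f.2 c hc q
    change f.1 (p ⊲ c) ⊳ r - secondLeft r (p ⊲ c) f.1 = p ⊲ (f.1 c ⊳ r - secondLeft r c f.1)
    rw [secondLeft_nuc f hc, sub_zero, secondLeft, nuc_left hc, hf, hf]
    have h1 := assoc_left_eq_middle r p (f.1 c)
    linear_combination (norm := module) -h1⟩

/-- `(r ⊙ f)(x) = r f(x) + B_r(f, x)` for right para-linear `f`. -/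
def HomRO.lsmul (r : 𝕆) (f : HomRO M M') : HomRO M M' :=
  ⟨{ toFun := fun x => r ⊲ f.1 x + secondRight r f.1 x
     map_add' := by
      intro x y; simp only [secondRight, add_rmul, lmul_add, map_add]; abel
     map_smul' := by
      intro a x
      simp only [secondRight, smul_rmul, lmul_smul, map_smul, smul_add, smul_sub,
        RingHom.id_apply] },
   by
    refine mem_HomRO_iff.mpr fun c hc p => ?_
    have hf := fun q => mem_HomRO_iff.mp f.2 c hc q
    change r ⊲ f.1 (c ⊳ p) + secondRight r f.1 (c ⊳ p) = (r ⊲ f.1 c + secondRight r f.1 c) ⊳ p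
    rw [secondRight_nuc f hc, add_zero, secondRight, nuc_right hc, hf, hf]
    have h1 := assoc_left_eq_middle p r (f.1 c)
    have h2 := assoc_left_eq_right p r (f.1 c)
    linear_combination (norm := module) h1 - h2⟩

/-- `(f ⊙ r)(x) = f(r x) - B_r(f, x)` for right para-linear `f`. -/
def HomRO.rsmul (f : HomRO M M') (r : 𝕆) : HomRO M M' :=
  ⟨{ toFun := fun x => f.1 (r ⊲ x) - secondRight r f.1 x
     map_add' := by
      intro x y; simp only [secondRight, add_rmul, lmul_add, map_add]; abel
     map_smul' := by
      intro a x
      simp only [secondRight, smul_rmul, lmul_smul, map_smul, smul_sub, RingHom.id_apply] },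
   by
    refine mem_HomRO_iff.mpr fun c hc p => ?_
    have hf := fun q => mem_HomRO_iff.mp f.2 c hc q
    change f.1 (r ⊲ (c ⊳ p)) - secondRight r f.1 (c ⊳ p) =
      (f.1 (r ⊲ c) - secondRight r f.1 c) ⊳ p
    rw [secondRight_nuc f hc, sub_zero, secondRight, ← nuc_mid hc, nuc_comm hc, nuc_right hc,
      nuc_right hc, hf, hf, hf, hf]
    have h1 := assoc_left_eq_right p r (f.1 c)
    have h2 := assoc_left_eq_right r p (f.1 c)
    have h3 := assoc_left_alt p r (f.1 c)
    linear_combination (norm := module) h1 + h2 - h3⟩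

theorem HomLO.lsmul_nuc (r : 𝕆) (f : HomLO M M') {c : M} (hc : c ∈ nucleus M) :
    (HomLO.lsmul r f).1 c = r ⊲ f.1 c := by
  change f.1 (c ⊳ r) + secondLeft r c f.1 = _
  rw [secondLeft_nuc f hc, add_zero, ← nuc_comm hc, mem_HomLO_iff.mp f.2 c hc]

theorem HomLO.rsmul_nuc (r : 𝕆) (f : HomLO M M') {c : M} (hc : c ∈ nucleus M) :
    (HomLO.rsmul f r).1 c = f.1 c ⊳ r := by
  change f.1 c ⊳ r - secondLeft r c f.1 = _
  rw [secondLeft_nuc f hc, sub_zero]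

theorem HomRO.lsmul_nuc (r : 𝕆) (f : HomRO M M') {c : M} (hc : c ∈ nucleus M) :
    (HomRO.lsmul r f).1 c = r ⊲ f.1 c := by
  change r ⊲ f.1 c + secondRight r f.1 c = _
  rw [secondRight_nuc f hc, add_zero]

theorem HomRO.rsmul_nuc (r : 𝕆) (f : HomRO M M') {c : M} (hc : c ∈ nucleus M) :
    (HomRO.rsmul f r).1 c = f.1 c ⊳ r := by
  change f.1 (r ⊲ c) - secondRight r f.1 c = _
  rw [secondRight_nuc f hc, sub_zero, nuc_comm hc, mem_HomRO_iff.mp f.2 c hc]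

theorem HomLO.add_apply (f g : HomLO M M') (x : M) : (f + g).1 x = f.1 x + g.1 x := rfl
theorem HomLO.sub_apply (f g : HomLO M M') (x : M) : (f - g).1 x = f.1 x - g.1 x := rfl
theorem HomLO.neg_apply (f : HomLO M M') (x : M) : (-f).1 x = -f.1 x := rfl
theorem HomLO.smul_apply (r : ℝ) (f : HomLO M M') (x : M) : (r • f).1 x = r • f.1 x := rfl
theorem HomRO.add_apply (f g : HomRO M M') (x : M) : (f + g).1 x = f.1 x + g.1 x := rfl
theorem HomRO.sub_apply (f g : HomRO M M') (x : M) : (f - g).1 x = f.1 x - g.1 x := rfl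
theorem HomRO.neg_apply (f : HomRO M M') (x : M) : (-f).1 x = -f.1 x := rfl
theorem HomRO.smul_apply (r : ℝ) (f : HomRO M M') (x : M) : (r • f).1 x = r • f.1 x := rfl

instance HomLO.bimodule : OctonionBimodule (HomLO M M') where
  lmul := HomLO.lsmul
  rmul := HomLO.rsmul
  lmul_add _ _ _ := HomLO_ext fun c hc => by
    simp only [HomLO.lsmul_nuc _ _ hc, HomLO.add_apply, lmul_add]
  add_lmul _ _ _ := HomLO_ext fun c hc => by
    simp only [HomLO.lsmul_nuc _ _ hc, HomLO.add_apply, add_lmul]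
  lmul_smul _ _ _ := HomLO_ext fun c hc => by
    simp only [HomLO.lsmul_nuc _ _ hc, HomLO.smul_apply, lmul_smul]
  smul_lmul _ _ _ := HomLO_ext fun c hc => by
    simp only [HomLO.lsmul_nuc _ _ hc, HomLO.smul_apply, smul_lmul]
  rmul_add _ _ _ := HomLO_ext fun c hc => by
    simp only [HomLO.rsmul_nuc _ _ hc, HomLO.add_apply, rmul_add]
  add_rmul _ _ _ := HomLO_ext fun c hc => by
    simp only [HomLO.rsmul_nuc _ _ hc, HomLO.add_apply, add_rmul]
  rmul_smul _ _ _ := HomLO_ext fun c hc => by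
    simp only [HomLO.rsmul_nuc _ _ hc, HomLO.smul_apply, rmul_smul]
  smul_rmul _ _ _ := HomLO_ext fun c hc => by
    simp only [HomLO.rsmul_nuc _ _ hc, HomLO.smul_apply, smul_rmul]
  one_lmul _ := HomLO_ext fun c hc => by simp only [HomLO.lsmul_nuc _ _ hc, one_lmul]
  rmul_one _ := HomLO_ext fun c hc => by simp only [HomLO.rsmul_nuc _ _ hc, rmul_one]
  assoc_left_alt p q f := HomLO_ext fun c hc => by
    simp only [HomLO.lsmul_nuc _ _ hc, HomLO.sub_apply, HomLO.neg_apply]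
    exact assoc_left_alt p q (f.1 c)
  assoc_left_eq_right p q f := HomLO_ext fun c hc => by
    simp only [HomLO.lsmul_nuc _ _ hc, HomLO.rsmul_nuc _ _ hc, HomLO.sub_apply]
    exact assoc_left_eq_right p q (f.1 c)
  assoc_left_eq_middle p q f := HomLO_ext fun c hc => by
    simp only [HomLO.lsmul_nuc _ _ hc, HomLO.rsmul_nuc _ _ hc, HomLO.sub_apply]
    exact assoc_left_eq_middle p q (f.1 c)

instance HomRO.bimodule : OctonionBimodule (HomRO M M') where
  lmul := HomRO.lsmul
  rmul := HomRO.rsmul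
  lmul_add _ _ _ := HomRO_ext fun c hc => by
    simp only [HomRO.lsmul_nuc _ _ hc, HomRO.add_apply, lmul_add]
  add_lmul _ _ _ := HomRO_ext fun c hc => by
    simp only [HomRO.lsmul_nuc _ _ hc, HomRO.add_apply, add_lmul]
  lmul_smul _ _ _ := HomRO_ext fun c hc => by
    simp only [HomRO.lsmul_nuc _ _ hc, HomRO.smul_apply, lmul_smul]
  smul_lmul _ _ _ := HomRO_ext fun c hc => by
    simp only [HomRO.lsmul_nuc _ _ hc, HomRO.smul_apply, smul_lmul]
  rmul_add _ _ _ := HomRO_ext fun c hc => by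
    simp only [HomRO.rsmul_nuc _ _ hc, HomRO.add_apply, rmul_add]
  add_rmul _ _ _ := HomRO_ext fun c hc => by
    simp only [HomRO.rsmul_nuc _ _ hc, HomRO.add_apply, add_rmul]
  rmul_smul _ _ _ := HomRO_ext fun c hc => by
    simp only [HomRO.rsmul_nuc _ _ hc, HomRO.smul_apply, rmul_smul]
  smul_rmul _ _ _ := HomRO_ext fun c hc => by
    simp only [HomRO.rsmul_nuc _ _ hc, HomRO.smul_apply, smul_rmul]
  one_lmul _ := HomRO_ext fun c hc => by simp only [HomRO.lsmul_nuc _ _ hc, one_lmul]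
  rmul_one _ := HomRO_ext fun c hc => by simp only [HomRO.rsmul_nuc _ _ hc, rmul_one]
  assoc_left_alt p q f := HomRO_ext fun c hc => by
    simp only [HomRO.lsmul_nuc _ _ hc, HomRO.sub_apply, HomRO.neg_apply]
    exact assoc_left_alt p q (f.1 c)
  assoc_left_eq_right p q f := HomRO_ext fun c hc => by
    simp only [HomRO.lsmul_nuc _ _ hc, HomRO.rsmul_nuc _ _ hc, HomRO.sub_apply]
    exact assoc_left_eq_right p q (f.1 c)
  assoc_left_eq_middle p q f := HomRO_ext fun c hc => by
    simp only [HomRO.lsmul_nuc _ _ hc, HomRO.rsmul_nuc _ _ hc, HomRO.sub_apply]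
    exact assoc_left_eq_middle p q (f.1 c)

/-- The left regular composition
`(f ⊚ g)(x) = f(g(x)) - ∑ j = 1, …, 7, e_j Re(f(A_{e_j}(x, g)))`. -/
noncomputable def HomLO.comp (f : HomLO M' M'') (g : HomLO M M') : HomLO M M'' :=
  ⟨{ toFun := fun x =>
      f.1 (g.1 x) - ∑ j : Fin 7, e j.succ ⊲ re (f.1 (secondLeft (e j.succ) x g.1))
     map_add' := by
      intro x y
      have h : ∀ p : 𝕆, secondLeft p (x + y) g.1 = secondLeft p x g.1 + secondLeft p y g.1 := by
        intro p; simp only [secondLeft, lmul_add, map_add]; abel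
      simp only [h, map_add, re_add, lmul_add, Finset.sum_add_distrib]; abel
     map_smul' := by
      intro a x
      have h : ∀ p : 𝕆, secondLeft p (a • x) g.1 = a • secondLeft p x g.1 := by
        intro p; simp only [secondLeft, lmul_smul, map_smul, smul_sub]
      simp only [h, map_smul, re_smul, lmul_smul, ← Finset.smul_sum, RingHom.id_apply, smul_sub] },
   by
    refine mem_HomLO_iff.mpr fun c hc p => ?_
    have hg := fun q => mem_HomLO_iff.mp g.2 c hc q
    have hf : ∀ (q : 𝕆) (x : M'), re (f.1 (q ⊲ x)) = re (q ⊲ f.1 x) := fun q x => by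
      have := f.2 q x
      rwa [secondLeft, re_sub, sub_eq_zero] at this
    change f.1 (g.1 (p ⊲ c)) - ∑ j : Fin 7, e j.succ ⊲ re (f.1 (secondLeft (e j.succ) (p ⊲ c) g.1)) =
      p ⊲ (f.1 (g.1 c) - ∑ j : Fin 7, e j.succ ⊲ re (f.1 (secondLeft (e j.succ) c g.1)))
    simp only [secondLeft_nuc g hc, map_zero, re_zero, lmul_zero, Finset.sum_const_zero, sub_zero]
    simp only [secondLeft, nuc_left hc, hg]
    refine sub_eq_zero.mp (eq_zero_of_re fun k => ?_)
    have hs : re (e k ⊲ ∑ j : Fin 7,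
        e j.succ ⊲ re (f.1 ((e j.succ * p) ⊲ g.1 c - e j.succ ⊲ p ⊲ g.1 c))) =
        - re (f.1 ((e k * p) ⊲ g.1 c - e k ⊲ p ⊲ g.1 c)) := by
      rw [lmul_sum, re_sum]
      refine Fin.cases ?_ (fun k => ?_) k
      · have h0 : ∀ z : M', e 0 ⊲ z = z := one_lmul
        have h1 : e 0 * p = p := Octonion.one_mul p
        rw [h0, h1, sub_self, map_zero, re_zero, neg_zero]
        refine Finset.sum_eq_zero fun j _ => ?_
        rw [nuc_left (re_mem _), re_lmul_nuc (re_mem _), e_mul_e_zero,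
          if_neg (Fin.succ_ne_zero j).symm, zero_smul]
      · rw [Finset.sum_eq_single k]
        · rw [nuc_left (re_mem _), re_lmul_nuc (re_mem _), e_mul_e_zero, if_pos rfl,
            if_neg (Fin.succ_ne_zero k), neg_one_smul]
        · intro j _ hj
          rw [nuc_left (re_mem _), re_lmul_nuc (re_mem _), e_mul_e_zero,
            if_neg (fun h => hj (Fin.succ_injective _ h).symm), zero_smul]
        · intro h; exact absurd (Finset.mem_univ k) h
    rw [lmul_sub, lmul_sub, re_sub, re_sub, hs, map_sub, re_sub, hf (e k * p), re_assoc (e k) p,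
      hf (e k)]
    abel⟩

/-- The right regular composition
`(f ⊚ g)(x) = f(g(x)) + ∑ j = 1, …, 7, Re(f(B_{e_j}(g, x))) e_j`. -/
noncomputable def HomRO.comp (f : HomRO M' M'') (g : HomRO M M') : HomRO M M'' :=
  ⟨{ toFun := fun x =>
      f.1 (g.1 x) + ∑ j : Fin 7, re (f.1 (secondRight (e j.succ) g.1 x)) ⊳ e j.succ
     map_add' := by
      intro x y
      have h : ∀ p : 𝕆, secondRight p g.1 (x + y) = secondRight p g.1 x + secondRight p g.1 y := by
        intro p; simp only [secondRight, add_rmul, map_add]; abel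
      simp only [h, map_add, re_add, add_rmul, Finset.sum_add_distrib]; abel
     map_smul' := by
      intro a x
      have h : ∀ p : 𝕆, secondRight p g.1 (a • x) = a • secondRight p g.1 x := by
        intro p; simp only [secondRight, smul_rmul, map_smul, smul_sub]
      simp only [h, map_smul, re_smul, smul_rmul, ← Finset.smul_sum, RingHom.id_apply, smul_add] },
   by
    refine mem_HomRO_iff.mpr fun c hc p => ?_
    have hg := fun q => mem_HomRO_iff.mp g.2 c hc q
    have hf : ∀ (q : 𝕆) (x : M'), re (f.1 (x ⊳ q)) = re (f.1 x ⊳ q) := fun q x => by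
      have := f.2 q x
      rw [secondRight, re_sub, sub_eq_zero] at this
      exact this.symm
    change f.1 (g.1 (c ⊳ p)) + ∑ j : Fin 7, re (f.1 (secondRight (e j.succ) g.1 (c ⊳ p))) ⊳ e j.succ =
      (f.1 (g.1 c) + ∑ j : Fin 7, re (f.1 (secondRight (e j.succ) g.1 c)) ⊳ e j.succ) ⊳ p
    simp only [secondRight_nuc g hc, map_zero, re_zero, zero_rmul, Finset.sum_const_zero, add_zero]
    simp only [secondRight, nuc_right hc, hg]
    refine sub_eq_zero.mp (eq_zero_of_re_right fun k => ?_)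
    have hs : re ((∑ j : Fin 7,
        re (f.1 (g.1 c ⊳ p ⊳ e j.succ - g.1 c ⊳ (p * e j.succ))) ⊳ e j.succ) ⊳ e k) =
        - re (f.1 (g.1 c ⊳ p ⊳ e k - g.1 c ⊳ (p * e k))) := by
      rw [sum_rmul, re_sum]
      refine Fin.cases ?_ (fun k => ?_) k
      · have h0 : ∀ z : M', z ⊳ e 0 = z := rmul_one
        have h1 : p * e 0 = p := Octonion.mul_one p
        rw [h0, h1, sub_self, map_zero, re_zero, neg_zero]
        refine Finset.sum_eq_zero fun j _ => ?_
        rw [nuc_right (re_mem _), ← nuc_comm (re_mem _), re_lmul_nuc (re_mem _), e_mul_e_zero,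
          if_neg (Fin.succ_ne_zero j), zero_smul]
      · rw [Finset.sum_eq_single k]
        · rw [nuc_right (re_mem _), ← nuc_comm (re_mem _), re_lmul_nuc (re_mem _), e_mul_e_zero,
            if_pos rfl, if_neg (Fin.succ_ne_zero k), neg_one_smul]
        · intro j _ hj
          rw [nuc_right (re_mem _), ← nuc_comm (re_mem _), re_lmul_nuc (re_mem _), e_mul_e_zero,
            if_neg (fun h => hj (Fin.succ_injective _ h)), zero_smul]
        · intro h; exact absurd (Finset.mem_univ k) h
    rw [sub_rmul, add_rmul, re_sub, re_add, hs, map_sub, re_sub, hf (p * e k), re_assoc_right p (e k),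
      hf (e k)]
    abel⟩

/-- The identity map as a left para-linear map. -/
def HomLO.id : HomLO M M :=
  ⟨LinearMap.id, fun p x => by simp [secondLeft, re_zero]⟩

/-- The identity map as a right para-linear map. -/
def HomRO.id : HomRO M M :=
  ⟨LinearMap.id, fun p x => by simp [secondRight, re_zero]⟩

theorem HomLO.comp_nuc (f : HomLO M' M'') (g : HomLO M M') {c : M} (hc : c ∈ nucleus M) :
    (HomLO.comp f g).1 c = f.1 (g.1 c) := by
  change f.1 (g.1 c) - ∑ j : Fin 7, e j.succ ⊲ re (f.1 (secondLeft (e j.succ) c g.1)) = _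
  simp only [secondLeft_nuc g hc, map_zero, re_zero, lmul_zero, Finset.sum_const_zero, sub_zero]

theorem HomRO.comp_nuc (f : HomRO M' M'') (g : HomRO M M') {c : M} (hc : c ∈ nucleus M) :
    (HomRO.comp f g).1 c = f.1 (g.1 c) := by
  change f.1 (g.1 c) + ∑ j : Fin 7, re (f.1 (secondRight (e j.succ) g.1 c)) ⊳ e j.succ = _
  simp only [secondRight_nuc g hc, map_zero, re_zero, zero_rmul, Finset.sum_const_zero, add_zero]

/-- A map between octonionic bimodules is `𝕆`-linear if it is real linear and commutes with the
multiplications by octonions on both sides. -/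
structure IsOctonionLinear (T : M → M') : Prop where
  map_add : ∀ x y, T (x + y) = T x + T y
  map_smul : ∀ (r : ℝ) (x : M), T (r • x) = r • T x
  map_lmul : ∀ (p : 𝕆) (x : M), T (p ⊲ x) = p ⊲ T x
  map_rmul : ∀ (p : 𝕆) (x : M), T (x ⊳ p) = T x ⊳ p

end hom
end OctonionBimodule

universe u v u' v'

/-- A non-associative category: composition has identities, but need not be associative. -/
structure NonassocCategory where
  Obj : Type u
  Hom : Obj → Obj → Type v
  id : ∀ X, Hom X X
  /-- `comp g f` is `f` followed by `g`. -/
  comp : ∀ {X Y Z}, Hom Y Z → Hom X Y → Hom X Z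
  comp_id : ∀ {X Y} (f : Hom X Y), comp f (id X) = f
  id_comp : ∀ {X Y} (f : Hom X Y), comp (id Y) f = f

/-- The assignments `obj` on objects and `map` on morphisms form a covariant functor. -/
structure IsCovariantFunctor (C : NonassocCategory.{u, v}) (D : NonassocCategory.{u', v'})
    (obj : C.Obj → D.Obj) (map : ∀ {X Y : C.Obj}, C.Hom X Y → D.Hom (obj X) (obj Y)) : Prop where
  map_comp : ∀ {X Y Z : C.Obj} (g : C.Hom Y Z) (f : C.Hom X Y),
    map (C.comp g f) = D.comp (map g) (map f)
  map_id : ∀ X : C.Obj, map (C.id X) = D.id (obj X)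

/-- The assignments `obj` on objects and `map` on morphisms form a contravariant functor. -/
structure IsContravariantFunctor (C : NonassocCategory.{u, v}) (D : NonassocCategory.{u', v'})
    (obj : C.Obj → D.Obj) (map : ∀ {X Y : C.Obj}, C.Hom X Y → D.Hom (obj Y) (obj X)) : Prop where
  map_comp : ∀ {X Y Z : C.Obj} (g : C.Hom Y Z) (f : C.Hom X Y),
    map (C.comp g f) = D.comp (map f) (map g)
  map_id : ∀ X : C.Obj, map (C.id X) = D.id (obj X)

/-- Bundled octonionic bimodules. -/
structure OBimod where
  carrier : Type u
  [addCommGroup : AddCommGroup carrier]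
  [module : Module ℝ carrier]
  [bimodule : OctonionBimodule carrier]

attribute [instance] OBimod.addCommGroup OBimod.module OBimod.bimodule

instance : CoeSort OBimod.{u} (Type u) := ⟨OBimod.carrier⟩

/-- The category `LO`: octonionic bimodules, left para-linear maps, left regular composition. -/
noncomputable abbrev LO : NonassocCategory.{u + 1, u} where
  Obj := OBimod.{u}
  Hom X Y := OctonionBimodule.HomLO X Y
  id _ := OctonionBimodule.HomLO.id
  comp g f := OctonionBimodule.HomLO.comp g f
  comp_id _ := OctonionBimodule.HomLO_ext fun _ hc => OctonionBimodule.HomLO.comp_nuc _ _ hc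
  id_comp _ := OctonionBimodule.HomLO_ext fun _ hc => OctonionBimodule.HomLO.comp_nuc _ _ hc

/-- The category `RO`: octonionic bimodules, right para-linear maps, right regular composition. -/
noncomputable abbrev RO : NonassocCategory.{u + 1, u} where
  Obj := OBimod.{u}
  Hom X Y := OctonionBimodule.HomRO X Y
  id _ := OctonionBimodule.HomRO.id
  comp g f := OctonionBimodule.HomRO.comp g f
  comp_id _ := OctonionBimodule.HomRO_ext fun _ hc => OctonionBimodule.HomRO.comp_nuc _ _ hc
  id_comp _ := OctonionBimodule.HomRO_ext fun _ hc => OctonionBimodule.HomRO.comp_nuc _ _ hc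

/-- `Hom_LO(M, N)` as an octonionic bimodule. -/
def homLO (M N : OBimod.{u}) : OBimod.{u} := ⟨OctonionBimodule.HomLO M N⟩

/-! The nucleus controls everything. By `mem_HomLO_iff` and `HomLO_ext`, a left para-linear map
satisfies f(pc) = p f(c) for nuclear c and is determined by its values on the nucleus; the
right-handed versions are `mem_HomRO_iff` and `HomRO_ext`. At a nuclear c the correction terms in
the definitions vanish, so the actions become pointwise, (p ⊙ f)(c) = p f(c) and (f ⊙ p)(c) = f(c)
p, and composition becomes (f ⊚ g)(c) = f(g(c)). The value f(c) itself is in general not nuclear,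
and all the difficulty lies there.

The Hom spaces are themselves bimodules, so an identity between maps out of them needs testing only
on a nuclear h in the Hom space, and the resulting identity between para-linear maps only at a
nuclear c. Such an h is much better than para-linear: it preserves the nucleus
(`HomLO.apply_mem_nucleus`), and hence is linear over the octonions on both sides and commutes with
Re (`HomLO.map_lmul_of_mem_nucleus`, `HomLO.map_rmul_of_mem_nucleus`,
`HomLO.re_apply_of_mem_nucleus`).

In the covariant case h acts first and h(c) is again nuclear, so the pointwise formulas apply a
second time, to f at h(c). In the contravariant case h acts last, on a value f(c) that need not be
nuclear; there the linearity of h makes its second associators vanish, so that h ⊚ f is the plain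
composite (`HomLO.comp_apply_of_mem_nucleus`). Functoriality thus requires associativity of ⊚ only
for triples whose first or last factor is nuclear, where both bracketings are the composite of the
three maps at c.

The change of side under S has a simple source: for nuclear g, (g ⊙ p)(f(c)) = g(f(c)) p, so the
scalar ends up on the right of the value. -/

namespace OctonionBimodule

section hom
variable {M X Y Z : Type*} [AddCommGroup M] [Module ℝ M] [OctonionBimodule M]
  [AddCommGroup X] [Module ℝ X] [OctonionBimodule X]
  [AddCommGroup Y] [Module ℝ Y] [OctonionBimodule Y]
  [AddCommGroup Z] [Module ℝ Z] [OctonionBimodule Z]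

/-! ### Nuclear elements of Hom spaces -/

/-- Associative elements of `Hom_LO(X, Y)` map associative elements to associative elements. -/
theorem HomLO.apply_mem_nucleus {g : HomLO X Y} (hg : g ∈ nucleus (HomLO X Y)) {c : X}
    (hc : c ∈ nucleus X) : g.1 c ∈ nucleus Y := by
  intro p q
  -- At a nuclear c the left action on maps is pointwise, so the associator [p, q, g] takes the
  -- value [p, q, g(c)] there.
  have h := congrArg (fun f : HomLO X Y => f.1 c) (hg p q)
  change (HomLO.lsmul (p * q) g).1 c - (HomLO.lsmul p (HomLO.lsmul q g)).1 c = 0 at h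
  rwa [lsmul_nuc _ _ hc, lsmul_nuc _ _ hc, lsmul_nuc _ _ hc] at h

/-- Associative elements of `Hom_LO(X, Y)` are left linear. -/
theorem HomLO.map_lmul_of_mem_nucleus {g : HomLO X Y} (hg : g ∈ nucleus (HomLO X Y)) (p : 𝕆)
    (x : X) : g.1 (p ⊲ x) = p ⊲ g.1 x := by
  refine nuc_induction (P := fun x => g.1 (p ⊲ x) = p ⊲ g.1 x) ?_ ?_ ?_ x
  · intro x y hx hy
    rw [lmul_add, map_add, map_add, lmul_add, hx, hy]
  · rw [lmul_zero, map_zero, lmul_zero]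
  · intro q c hc
    -- g(p(qc)) = g((pq)c) = (pq)g(c) = p(q g(c)) = p g(qc); the third equality is the one that
    -- needs g(c) to be nuclear.
    rw [nuc_left hc, mem_HomLO_iff.mp g.2 c hc, mem_HomLO_iff.mp g.2 c hc,
      nuc_left (apply_mem_nucleus hg hc)]

/-- Associative elements of `Hom_LO(X, Y)` are right linear. -/
theorem HomLO.map_rmul_of_mem_nucleus {g : HomLO X Y} (hg : g ∈ nucleus (HomLO X Y)) (p : 𝕆)
    (x : X) : g.1 (x ⊳ p) = g.1 x ⊳ p := by
  refine nuc_induction (P := fun x => g.1 (x ⊳ p) = g.1 x ⊳ p) ?_ ?_ ?_ x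
  · intro x y hx hy
    rw [add_rmul, map_add, map_add, add_rmul, hx, hy]
  · rw [zero_rmul, map_zero, zero_rmul]
  · intro q c hc
    have hgc := apply_mem_nucleus hg hc
    -- Nuclear elements commute with octonions, which turns right multiplication into left: (qc)p =
    -- q(cp) = q(pc). The same manipulation is available for g(c), which is nuclear too.
    rw [nuc_mid hc, ← nuc_comm hc, map_lmul_of_mem_nucleus hg, map_lmul_of_mem_nucleus hg,
      map_lmul_of_mem_nucleus hg, nuc_mid hgc, ← nuc_comm hgc]

/-- Associative elements of `Hom_LO(X, Y)` commute with the real part. -/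
theorem HomLO.re_apply_of_mem_nucleus {g : HomLO X Y} (hg : g ∈ nucleus (HomLO X Y)) (x : X) :
    re (g.1 x) = g.1 (re x) := by
  refine nuc_induction (P := fun x => re (g.1 x) = g.1 (re x)) ?_ ?_ ?_ x
  · intro x y hx hy
    rw [map_add, re_add, re_add, map_add, hx, hy]
  · rw [map_zero, re_zero, re_zero, map_zero]
  · intro q c hc
    -- Both sides equal q₀ g(c), where q₀ is the real coordinate of q.
    rw [map_lmul_of_mem_nucleus hg, re_lmul_nuc (apply_mem_nucleus hg hc), re_lmul_nuc hc, map_smul]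

/-- Composition with an associative left factor is composition of maps. -/
theorem HomLO.comp_apply_of_mem_nucleus {h : HomLO Y Z} (hh : h ∈ nucleus (HomLO Y Z))
    (f : HomLO X Y) (x : X) : (HomLO.comp h f).1 x = h.1 (f.1 x) := by
  change h.1 (f.1 x) - ∑ j : Fin 7, e j.succ ⊲ re (h.1 (secondLeft (e j.succ) x f.1)) = _
  -- Each correction term vanishes: Re passes through h, and Re A_p(x, f) = 0 is the para-linearity
  -- of f.
  have hz : ∀ p : 𝕆, re (h.1 (secondLeft p x f.1)) = 0 := fun p => by
    rw [re_apply_of_mem_nucleus hh, f.2 p x, map_zero]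
  simp only [hz, lmul_zero, Finset.sum_const_zero, sub_zero]

/-- For associative `g`, the identity `(g ⊙ p)(x) = g(x) p` holds at every `x`. -/
theorem HomLO.rmul_apply_of_mem_nucleus {g : HomLO X Y} (hg : g ∈ nucleus (HomLO X Y)) (p : 𝕆)
    (x : X) : (g ⊳ p).1 x = g.1 x ⊳ p := by
  change g.1 x ⊳ p - (g.1 (p ⊲ x) - p ⊲ g.1 x) = _
  rw [map_lmul_of_mem_nucleus hg, sub_self, sub_zero]

/-! ### Real bilinearity of the regular composition -/

theorem HomLO.comp_add (f : HomLO Y Z) (g h : HomLO X Y) :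
    HomLO.comp f (g + h) = HomLO.comp f g + HomLO.comp f h :=
  HomLO_ext fun c hc => by simp only [comp_nuc _ _ hc, add_apply, map_add]

theorem HomLO.comp_smul (f : HomLO Y Z) (r : ℝ) (g : HomLO X Y) :
    HomLO.comp f (r • g) = r • HomLO.comp f g :=
  HomLO_ext fun c hc => by simp only [comp_nuc _ _ hc, smul_apply, map_smul]

theorem HomLO.add_comp (f g : HomLO Y Z) (h : HomLO X Y) :
    HomLO.comp (f + g) h = HomLO.comp f h + HomLO.comp g h :=
  HomLO_ext fun c hc => by simp only [comp_nuc _ _ hc, add_apply]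

theorem HomLO.smul_comp (r : ℝ) (f : HomLO Y Z) (g : HomLO X Y) :
    HomLO.comp (r • f) g = r • HomLO.comp f g :=
  HomLO_ext fun c hc => by simp only [comp_nuc _ _ hc, smul_apply]

/-! ### Post- and precomposition as para-linear maps -/

variable (M) in
/-- Composition with `f` on the left, as a left para-linear map. -/
noncomputable def HomLO.postcomp (f : HomLO X Y) : HomLO (HomLO M X) (HomLO M Y) :=
  ⟨{ toFun := fun g => HomLO.comp f g
     map_add' := comp_add f
     map_smul' := comp_smul f },
   mem_HomLO_iff.mpr fun g hg p => HomLO_ext fun c hc => by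
    change (HomLO.comp f (HomLO.lsmul p g)).1 c = (HomLO.lsmul p (HomLO.comp f g)).1 c
    -- The claim is now f(p g(c)) = p f(g(c)), the para-linearity of f at the nuclear element g(c).
    rw [comp_nuc _ _ hc, lsmul_nuc _ _ hc, lsmul_nuc _ _ hc, comp_nuc _ _ hc,
      mem_HomLO_iff.mp f.2 _ (apply_mem_nucleus hg hc)]⟩

variable (M) in
/-- Composition with `f` on the right, as a right para-linear map. -/
noncomputable def HomLO.precomp (f : HomLO X Y) : HomRO (HomLO Y M) (HomLO X M) :=
  ⟨{ toFun := fun g => HomLO.comp g f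
     map_add' := fun g h => add_comp g h f
     map_smul' := fun r g => smul_comp r g f },
   mem_HomRO_iff.mpr fun g hg p => HomLO_ext fun c hc => by
    change (HomLO.comp (g ⊳ p) f).1 c = (HomLO.rsmul (HomLO.comp g f) p).1 c
    -- The map g ⊙ p is evaluated at f(c), which need not be nuclear; the pointwise formula holds
    -- there because g is nuclear.
    rw [comp_nuc _ _ hc, rmul_apply_of_mem_nucleus hg, rsmul_nuc _ _ hc, comp_nuc _ _ hc]⟩

theorem HomLO.postcomp_apply (f : HomLO X Y) (g : HomLO M X) :
    (postcomp M f).1 g = HomLO.comp f g := rfl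

theorem HomLO.precomp_apply (f : HomLO X Y) (g : HomLO Y M) :
    (precomp M f).1 g = HomLO.comp g f := rfl

/-! ### Functoriality -/

/-- On a nuclear h this is (f ⊚ g) ⊚ h = f ⊚ (g ⊚ h). Since h(c) is nuclear when c is, both sides
send c to f(g(h(c))). -/
theorem HomLO.postcomp_comp (f : HomLO Y Z) (g : HomLO X Y) :
    postcomp M (HomLO.comp f g) = HomLO.comp (postcomp M f) (postcomp M g) :=
  HomLO_ext fun h hh => HomLO_ext fun c hc => by
    rw [comp_nuc _ _ hh, postcomp_apply, postcomp_apply, postcomp_apply, comp_nuc _ _ hc,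
      comp_nuc _ _ (apply_mem_nucleus hh hc), comp_nuc _ _ hc, comp_nuc _ _ hc]

/-- On a nuclear h this is h ⊚ (f ⊚ g) = (h ⊚ f) ⊚ g. The right side evaluates h ⊚ f at g(c),
possibly outside the nucleus, so the nuclear formula for a composite does not apply; h being
nuclear, h ⊚ f is the plain composite everywhere. -/
theorem HomLO.precomp_comp (f : HomLO Y Z) (g : HomLO X Y) :
    precomp M (HomLO.comp f g) = HomRO.comp (precomp M g) (precomp M f) :=
  HomRO_ext fun h hh => HomLO_ext fun c hc => by
    rw [HomRO.comp_nuc _ _ hh, precomp_apply, precomp_apply, precomp_apply, comp_nuc _ _ hc,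
      comp_nuc _ _ hc, comp_nuc _ _ hc, comp_apply_of_mem_nucleus hh]

theorem HomLO.postcomp_id : postcomp M (HomLO.id : HomLO X X) = HomLO.id :=
  HomLO_ext fun _ _ => HomLO_ext fun _ hc => comp_nuc _ _ hc

theorem HomLO.precomp_id : precomp M (HomLO.id : HomLO X X) = HomRO.id :=
  HomRO_ext fun _ _ => HomLO_ext fun _ hc => comp_nuc _ _ hc

/-! ### Linearity of the functors over the octonions -/

/-- For nuclear h and c, the element h(c) is nuclear, so p ⊙ f and f ⊙ p take the values p f(h(c))
and f(h(c)) p at it. The actions on the outer Hom space, evaluated first at h and then at c, give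
the same values. -/
theorem HomLO.isOctonionLinear_postcomp :
    IsOctonionLinear (fun f : HomLO X Y => postcomp M f) where
  map_add f g := HomLO_ext fun h _ => add_comp f g h
  map_smul r f := HomLO_ext fun h _ => smul_comp r f h
  map_lmul p f := HomLO_ext fun h hh => HomLO_ext fun c hc => by
    change (HomLO.comp (lsmul p f) h).1 c = ((lsmul p (postcomp M f)).1 h).1 c
    -- Two nested actions are unfolded: this one moves p from T(f) to the map T(f)(h), and a later
    -- use at c moves it to the value.
    rw [lsmul_nuc _ _ hh]
    change _ = (lsmul p (HomLO.comp f h)).1 c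
    rw [comp_nuc _ _ hc, lsmul_nuc _ _ (apply_mem_nucleus hh hc), lsmul_nuc _ _ hc,
      comp_nuc _ _ hc]
  map_rmul p f := HomLO_ext fun h hh => HomLO_ext fun c hc => by
    change (HomLO.comp (rsmul f p) h).1 c = ((rsmul (postcomp M f) p).1 h).1 c
    rw [rsmul_nuc _ _ hh]
    change _ = (rsmul (HomLO.comp f h) p).1 c
    rw [comp_nuc _ _ hc, rsmul_nuc _ _ (apply_mem_nucleus hh hc), rsmul_nuc _ _ hc,
      comp_nuc _ _ hc]

/-- Here h is applied to p f(c) or f(c) p, with f(c) arbitrary. The scalar comes out on the side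
where it stands because a nuclear h is linear on both sides. -/
theorem HomLO.isOctonionLinear_precomp :
    IsOctonionLinear (fun f : HomLO X Y => precomp M f) where
  map_add f g := HomRO_ext fun h _ => comp_add h f g
  map_smul r f := HomRO_ext fun h _ => comp_smul h r f
  map_lmul p f := HomRO_ext fun h hh => HomLO_ext fun c hc => by
    change (HomLO.comp h (lsmul p f)).1 c = ((HomRO.lsmul p (precomp M f)).1 h).1 c
    -- The outer action is that of `HomRO`, as S(f) is right para-linear; the inner one, on S(f)(h),
    -- is again that of `HomLO`.
    rw [HomRO.lsmul_nuc _ _ hh]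
    change _ = (lsmul p (HomLO.comp h f)).1 c
    rw [comp_nuc _ _ hc, lsmul_nuc _ _ hc, lsmul_nuc _ _ hc, comp_nuc _ _ hc,
      map_lmul_of_mem_nucleus hh]
  map_rmul p f := HomRO_ext fun h hh => HomLO_ext fun c hc => by
    change (HomLO.comp h (rsmul f p)).1 c = ((HomRO.rsmul (precomp M f) p).1 h).1 c
    rw [HomRO.rsmul_nuc _ _ hh]
    change _ = (rsmul (HomLO.comp h f) p).1 c
    rw [comp_nuc _ _ hc, rsmul_nuc _ _ hc, rsmul_nuc _ _ hc, comp_nuc _ _ hc,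
      map_rmul_of_mem_nucleus hh]

end hom
end OctonionBimodule

/-- Para-linearity of T(f) and S(f) is carried by the types of `T` and `S`. The composition formulas
determine both assignments completely, so the existential quantifiers leave no freedom. -/
theorem mainTheorem1 (M : OBimod.{u}) :
    (∃ T : ∀ {X Y : LO.{u}.Obj}, LO.Hom X Y → LO.Hom (homLO M X) (homLO M Y),
      (∀ (X Y : OBimod.{u}) (f : OctonionBimodule.HomLO X Y) (g : OctonionBimodule.HomLO M X),
        (T f).1 g = OctonionBimodule.HomLO.comp f g) ∧
      IsCovariantFunctor LO.{u} LO.{u} (fun X => homLO M X) T ∧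
      ∀ X Y : OBimod.{u}, OctonionBimodule.IsOctonionLinear
        (M := OctonionBimodule.HomLO X Y)
        (M' := OctonionBimodule.HomLO (homLO M X) (homLO M Y)) (fun f => T f)) ∧
    (∃ S : ∀ {X Y : LO.{u}.Obj}, LO.Hom X Y → RO.Hom (homLO Y M) (homLO X M),
      (∀ (X Y : OBimod.{u}) (f : OctonionBimodule.HomLO X Y) (g : OctonionBimodule.HomLO Y M),
        (S f).1 g = OctonionBimodule.HomLO.comp g f) ∧
      IsContravariantFunctor LO.{u} RO.{u} (fun X => homLO X M) S ∧
      ∀ X Y : OBimod.{u}, OctonionBimodule.IsOctonionLinear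
        (M := OctonionBimodule.HomLO X Y)
        (M' := OctonionBimodule.HomRO (homLO Y M) (homLO X M)) (fun f => S f)) := by
  refine ⟨⟨fun {_ _} f => OctonionBimodule.HomLO.postcomp M f, fun _ _ _ _ => rfl, ⟨?_, ?_⟩, ?_⟩,
    ⟨fun {_ _} f => OctonionBimodule.HomLO.precomp M f, fun _ _ _ _ => rfl, ⟨?_, ?_⟩, ?_⟩⟩
  · exact fun g f => OctonionBimodule.HomLO.postcomp_comp g f
  · exact fun _ => OctonionBimodule.HomLO.postcomp_id
  · exact fun _ _ => OctonionBimodule.HomLO.isOctonionLinear_postcomp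
  · exact fun g f => OctonionBimodule.HomLO.precomp_comp g f
  · exact fun _ => OctonionBimodule.HomLO.precomp_id
  · exact fun _ _ => OctonionBimodule.HomLO.isOctonionLinear_precomp
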